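/- Let $K$ be an algebraically closed field of characteristic $p>0$. A parametrization of a plane branch is a nonzero pair $\psi=(x(t),y(t))\in (tK[[t]])^2$, identified with the $K$-algebra morphism $K[[x,y]]\to K[[t]]$, $x\mapsto x(t)$, $y\mapsto y(t)$; it is primitive if $\dim_K K[[t]]/K[[x(t),y(t)]]<\infty$. Two parametrizations are $\mathcal A$-equivalent ($\sim_{\mathcal A}$) if they differ by composition with $K$-algebra automorphisms of $K[[x,y]]$ and of $K[[t]]$. For primitive $\psi$ put $$\Gamma=\{\operatorname{ord}_t h\mid 0\ne h\in K[[x(t),y(t)]]\},\qquad c(\Gamma)=\min\{c\in\Gamma\mid c+n\in\Gamma\ \text{for all } n\ge 0\},$$ let $m(\Gamma)$ be the least nonzero element of $\Gamma$, let $\Omega\subset K[[t]]$ be the $K[[x(t),y(t)]]$-submodule generated by $x'(t)$ and $y'(t)$, and put $$\Lambda=\{\operatorname{ord}_t w+1\mid 0\neq w\in\Omega\}\cup\{0\},\qquad \lambda=\min(\Lambda\setminus\Gamma)-m(\Gamma),$$ with $\lambda=\infty$ if $\Lambda\setminus\Gamma=\emptyset$. **Corollary 7.6.** Let $\psi=(t^a,\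 t^b+\sum_{i>b}a_it^i)$ be a primitive parametrization with $1\le a<b$, and $a\nmid b$ unless $a=1$. Assume that $p>c(\Gamma)$. Then there exist $b_i\in K$ such that $$\psi\ \sim_{\mathcal A}\ \Bigl(t^a,\ t^b+t^\lambda+\sum_{i>\lambda,\ i+a\notin\Lambda}b_it^i\Bigr),$$ where $\Gamma,\Lambda,\lambda$ are those of $\psi$, and where for $\lambda=\infty$ the right-hand side is $(t^a,t^b)$. -/

import Mathlib

open scoped PowerSeries

/-- A parametrization of an algebroid plane curve singularity over `K`: a pair
`(x(t), y(t))` of power series without constant term, not both zero. -/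
structure PlaneParametrization (K : Type*) [Field K] where
  x : K⟦X⟧
  y : K⟦X⟧
  constantCoeff_x : PowerSeries.constantCoeff x = 0
  constantCoeff_y : PowerSeries.constantCoeff y = 0
  ne_zero : x ≠ 0 ∨ y ≠ 0

namespace PlaneParametrization

variable {K : Type*} [Field K]

theorem hasSubst (ψ : PlaneParametrization K) :
    MvPowerSeries.HasSubst (S := K) (τ := Unit) ![ψ.x, ψ.y] :=
  MvPowerSeries.hasSubst_of_constantCoeff_zero fun i => by
    fin_cases i
    · exact ψ.constantCoeff_x
    · exact ψ.constantCoeff_y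

/-- The morphism of `K`-algebras `K⟦x, y⟧ → K⟦t⟧`, `x ↦ x(t)`, `y ↦ y(t)`
(substitution of `x(t), y(t)` into power series in two variables). -/
noncomputable def toAlgHom (ψ : PlaneParametrization K) :
    MvPowerSeries (Fin 2) K →ₐ[K] K⟦X⟧ :=
  MvPowerSeries.substAlgHom ψ.hasSubst

theorem toAlgHom_X_zero (ψ : PlaneParametrization K) :
    ψ.toAlgHom (MvPowerSeries.X 0) = ψ.x :=
  MvPowerSeries.substAlgHom_X ψ.hasSubst 0

theorem toAlgHom_X_one (ψ : PlaneParametrization K) :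
    ψ.toAlgHom (MvPowerSeries.X 1) = ψ.y :=
  MvPowerSeries.substAlgHom_X ψ.hasSubst 1

/-- Left-right equivalence: `ψ` and `φ` lie in the same orbit under the group of pairs
`(l, r)` of `K`-algebra automorphisms of `K⟦x, y⟧` and of `K⟦t⟧`. -/
def AEquiv (ψ φ : PlaneParametrization K) : Prop :=
  ∃ (l : MvPowerSeries (Fin 2) K ≃ₐ[K] MvPowerSeries (Fin 2) K) (r : K⟦X⟧ ≃ₐ[K] K⟦X⟧),
    φ.toAlgHom = (r : K⟦X⟧ →ₐ[K] K⟦X⟧).comp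
      (ψ.toAlgHom.comp (l : MvPowerSeries (Fin 2) K →ₐ[K] MvPowerSeries (Fin 2) K))

/-- The local ring `K⟦x(t), y(t)⟧ ⊆ K⟦t⟧` of the branch. -/
noncomputable def ring (ψ : PlaneParametrization K) : Subalgebra K K⟦X⟧ :=
  ψ.toAlgHom.range

/-- A parametrization is primitive if its delta invariant
`dim_K K⟦t⟧ / K⟦x(t), y(t)⟧` is finite. -/
def IsPrimitive (ψ : PlaneParametrization K) : Prop :=
  FiniteDimensional K (K⟦X⟧ ⧸ Subalgebra.toSubmodule ψ.ring)

/-- The semigroup of values `Γ` (orders of nonzero elements of the local ring). -/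
def semigroup (ψ : PlaneParametrization K) : Set ℕ :=
  {n | ∃ h ∈ ψ.ring, PowerSeries.order h = n}

/-- The conductor `c(Γ)`; the set is non-empty when the parametrization is primitive. -/
noncomputable def conductor (ψ : PlaneParametrization K) : ℕ :=
  sInf {c | c ∈ ψ.semigroup ∧ ∀ n : ℕ, c + n ∈ ψ.semigroup}

/-- The multiplicity `m(Γ)`: the least nonzero element of `Γ`. -/
noncomputable def multiplicity (ψ : PlaneParametrization K) : ℕ :=
  sInf {n | n ∈ ψ.semigroup ∧ n ≠ 0}

/-- `Ω`, the `K⟦x(t), y(t)⟧`-submodule of `K⟦t⟧` generated by `dx/dt` and `dy/dt`. -/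
noncomputable def differentials (ψ : PlaneParametrization K) : Submodule ψ.ring K⟦X⟧ :=
  Submodule.span ψ.ring {PowerSeries.derivative K ψ.x, PowerSeries.derivative K ψ.y}

/-- The semimodule `Λ = (ord Ω + 1) ∪ {0}` of values of differentials. -/
def semimodule (ψ : PlaneParametrization K) : Set ℕ :=
  {s | ∃ w ∈ ψ.differentials, ∃ n : ℕ, PowerSeries.order w = n ∧ s = n + 1} ∪ {0}

/-- The Zariski number `λ = min (Λ ∖ Γ) - m(Γ)`, equal to `∞` if `Λ ∖ Γ` is empty. -/
noncomputable def zariskiNumber (ψ : PlaneParametrization K) : ℕ∞ :=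
  (⨅ s ∈ ψ.semimodule \ ψ.semigroup, (s : ℕ∞)) - (ψ.multiplicity : ℕ∞)

end PlaneParametrization

/-! The proof is Zariski's elimination of terms by tangent vectors to the orbit, with the
exponential of a vector field replaced by a truncated exponential that makes sense in characteristic
`p`.

Suppose a differential `A dx + B dy` pulls back to `h dx` with `ord h = n`. Then the vector field `A
∂_y - B ∂_x` on the plane, together with a suitable multiple of `d/dt` on the line, fixes `x` and
moves `y` by `h` to first order. If `A` has weight above `b` and `B` weight above `a`, where `x` and
`y` have weights `a` and `b`, both fields raise filtrations and can be exponentiated. The series is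
cut at degree `p`, so that only factorials prime to `p` occur; the truncation errors have order at
least `p`, and all orders that matter are below `c(Γ) < p`. Hence the coefficient of `t^n` in `y`
can be changed at will, modulo higher terms, whenever such a form has value `n + a`
(`exists_aequiv_of_differential`, `IsClose.exists_aequiv_add`).

Below `λ`, a nonzero coefficient of `t^k` forces `k + a ∈ Λ` through the form `a x dy - b y dx`.
Minimality of `λ` gives `k + a ∈ Γ`, even `k + a ∈ ⟨a, b⟩`, and a monomial form removes the term
(`IsClose.exists_aequiv_succ`). At `λ` the coefficient cannot vanish, and rescaling makes it `1`.
Beyond `λ`, every form of value greater than `λ + a` automatically satisfies the weight conditions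
(`IsClose.weight_of_coeff_eq_zero`), so all terms with `i + a ∈ Λ` can be removed. Terms of order at
least `c(Γ)` lie in the local ring and are subtracted by a change of the coordinate `y`
(`IsClose.aequiv_of_dvd_sub`). Invariance of `Γ` and `Λ` under equivalence ties the steps together.
-/

namespace MvPowerSeries

/-! ### Weight filtrations and substitution automorphisms. -/

variable {σ R : Type*} [CommRing R]

/-- The ideal of power series all of whose terms have weight at least `n`. -/
def weightIdeal (R : Type*) [CommRing R] (w : σ → ℕ) (n : ℕ) : Ideal (MvPowerSeries σ R) where
  carrier := {f | ∀ d, Finsupp.weight w d < n → coeff d f = 0}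
  add_mem' hf hg d hd := by rw [map_add, hf d hd, hg d hd, add_zero]
  zero_mem' d _ := by rw [map_zero]
  smul_mem' c f hf d hd := by
    classical
    rw [smul_eq_mul, coeff_mul]
    refine Finset.sum_eq_zero fun x hx => ?_
    rw [Finset.HasAntidiagonal.mem_antidiagonal] at hx
    rw [← hx, map_add] at hd
    rw [hf x.2 (by omega), mul_zero]

theorem mem_weightIdeal {w : σ → ℕ} {n : ℕ} {f : MvPowerSeries σ R} :
    f ∈ weightIdeal R w n ↔ ∀ d, Finsupp.weight w d < n → coeff d f = 0 := Iff.rfl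

theorem weightIdeal_antitone (w : σ → ℕ) : Antitone (weightIdeal R w) :=
  fun _ _ h _ hf d hd => hf d (hd.trans_le h)

theorem mem_weightIdeal_zero (w : σ → ℕ) (f : MvPowerSeries σ R) : f ∈ weightIdeal R w 0 :=
  fun _ hd => absurd hd (Nat.not_lt_zero _)

theorem mul_mem_weightIdeal {w : σ → ℕ} {m n : ℕ} {f g : MvPowerSeries σ R}
    (hf : f ∈ weightIdeal R w m) (hg : g ∈ weightIdeal R w n) :
    f * g ∈ weightIdeal R w (m + n) := by
  classical
  intro d hd
  rw [coeff_mul]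
  refine Finset.sum_eq_zero fun x hx => ?_
  rw [Finset.HasAntidiagonal.mem_antidiagonal] at hx
  rw [← hx, map_add] at hd
  rcases lt_or_ge (Finsupp.weight w x.1) m with h | h
  · rw [hf _ h, zero_mul]
  · rw [hg x.2 (by omega), mul_zero]

theorem eq_zero_of_forall_mem_weightIdeal {w : σ → ℕ} {f : MvPowerSeries σ R}
    (h : ∀ n, f ∈ weightIdeal R w n) : f = 0 := by
  ext d
  exact h _ d (Nat.lt_succ_self _)

theorem X_mem_weightIdeal (w : σ → ℕ) (s : σ) : (X s : MvPowerSeries σ R) ∈ weightIdeal R w (w s) := by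
  classical
  intro d hd
  rw [coeff_X, if_neg]
  rintro rfl
  simp [Finsupp.weight_single] at hd

/-- The identity `ff' - gg' = (f - g)f' + g(f' - g')` shows that a gain of `m` in weight on each
factor is inherited by products. -/
theorem prod_sub_prod_mem_weightIdeal {w : σ → ℕ} {m : ℕ} {a : σ → MvPowerSeries σ R}
    (ha : ∀ s, a s - X s ∈ weightIdeal R w (w s + m)) (d : σ →₀ ℕ) :
    (d.prod fun s e => a s ^ e) - (d.prod fun s e => (X s : MvPowerSeries σ R) ^ e) ∈
      weightIdeal R w (Finsupp.weight w d + m) := by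
  classical
  have hmul : ∀ (n n' : ℕ) (f g f' g' : MvPowerSeries σ R),
      (g ∈ weightIdeal R w n ∧ f - g ∈ weightIdeal R w (n + m)) →
      (g' ∈ weightIdeal R w n' ∧ f' - g' ∈ weightIdeal R w (n' + m)) →
      (g * g' ∈ weightIdeal R w (n + n') ∧ f * f' - g * g' ∈ weightIdeal R w (n + n' + m)) := by
    rintro n n' f g f' g' ⟨h1, h2⟩ ⟨h3, h4⟩
    refine ⟨mul_mem_weightIdeal h1 h3, ?_⟩
    have hf' : f' ∈ weightIdeal R w n' := by
      have := Ideal.add_mem _ (weightIdeal_antitone w (Nat.le_add_right n' m) h4) h3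
      simpa using this
    have e : f * f' - g * g' = (f - g) * f' + g * (f' - g') := by ring
    rw [e]
    refine Ideal.add_mem _ ?_ ?_
    · have := mul_mem_weightIdeal h2 hf'
      rwa [show n + m + n' = n + n' + m by omega] at this
    · have := mul_mem_weightIdeal h1 h4
      rwa [← add_assoc] at this
  have hone : ∀ (g : MvPowerSeries σ R), g = 1 →
      (g ∈ weightIdeal R w 0 ∧ g - g ∈ weightIdeal R w (0 + m)) := fun g _ =>
    ⟨mem_weightIdeal_zero w g, by rw [sub_self]; exact Ideal.zero_mem _⟩
  have hpow : ∀ s e, ((X s : MvPowerSeries σ R) ^ e ∈ weightIdeal R w (e * w s) ∧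
      a s ^ e - X s ^ e ∈ weightIdeal R w (e * w s + m)) := by
    intro s e
    induction e with
    | zero => simpa using hone 1 rfl
    | succ e ih =>
      rw [pow_succ, pow_succ, Nat.succ_mul]
      exact hmul _ _ _ _ _ _ ih ⟨X_mem_weightIdeal w s, ha s⟩
  have key : ∀ S : Finset σ, (∏ s ∈ S, (X s : MvPowerSeries σ R) ^ d s) ∈
        weightIdeal R w (∑ s ∈ S, d s * w s) ∧
      (∏ s ∈ S, a s ^ d s) - (∏ s ∈ S, (X s : MvPowerSeries σ R) ^ d s) ∈
        weightIdeal R w (∑ s ∈ S, d s * w s + m) := by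
    intro S
    induction S using Finset.induction_on with
    | empty => simpa using hone 1 rfl
    | insert s S hs ih =>
      rw [Finset.prod_insert hs, Finset.prod_insert hs, Finset.sum_insert hs]
      exact hmul _ _ _ _ _ _ (hpow s _) ih
  have := (key d.support).2
  simpa [Finsupp.prod, Finsupp.weight_apply, Finsupp.sum] using this

theorem subst_sub_mem_weightIdeal {w : σ → ℕ} {m : ℕ} {a : σ → MvPowerSeries σ R}
    (hs : HasSubst a) (ha : ∀ s, a s - X s ∈ weightIdeal R w (w s + m)) {n : ℕ}
    {f : MvPowerSeries σ R} (hf : f ∈ weightIdeal R w n) :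
    subst a f - f ∈ weightIdeal R w (n + m) := by
  intro e he
  have h1 := coeff_subst hs f e
  have h2 := coeff_subst (R := R) (HasSubst.X (S := R) (σ := σ)) f e
  rw [subst_self, id] at h2
  rw [map_sub, h1, h2, sub_eq_zero]
  refine finsum_congr fun d => ?_
  rcases lt_or_ge (Finsupp.weight w d) n with h | h
  · rw [hf d h, zero_smul, zero_smul]
  · congr 1
    have := prod_sub_prod_mem_weightIdeal ha d e (by omega)
    rwa [map_sub, sub_eq_zero] at this

/-- A map that is the identity up to higher weight is inverted by the Neumann series `∑ (1 - L)^i`,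
which converges in the weight filtration. -/
theorem bijective_of_sub_mem_weightIdeal {w : σ → ℕ}
    (L : MvPowerSeries σ R →ₗ[R] MvPowerSeries σ R)
    (hL : ∀ n, ∀ f ∈ weightIdeal R w n, L f - f ∈ weightIdeal R w (n + 1)) :
    Function.Bijective L := by
  have hL' : ∀ n, ∀ f ∈ weightIdeal R w n, L f ∈ weightIdeal R w n := fun n f hf => by
    have := Ideal.add_mem _ (weightIdeal_antitone w (Nat.le_succ n) (hL n f hf)) hf
    simpa using this
  constructor
  · rw [injective_iff_map_eq_zero]
    intro f hf
    refine eq_zero_of_forall_mem_weightIdeal (w := w) fun n => ?_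
    induction n with
    | zero => exact mem_weightIdeal_zero w f
    | succ n ih => simpa [hf] using (Ideal.neg_mem_iff _).mpr (hL n f ih)
  · intro g
    let G : ℕ → MvPowerSeries σ R := fun n => (fun h => h - L h)^[n] g
    have hG : ∀ n, G n ∈ weightIdeal R w n := by
      intro n
      induction n with
      | zero => exact mem_weightIdeal_zero w _
      | succ n ih =>
        have : G (n + 1) = -(L (G n) - G n) := by
          simp only [G, Function.iterate_succ_apply', neg_sub]
        rw [this]
        exact (Ideal.neg_mem_iff _).mpr (hL n _ ih)
    have hsum : ∀ n, L (∑ i ∈ Finset.range n, G i) = g - G n := by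
      intro n
      induction n with
      | zero => simp [G]
      | succ n ih =>
        rw [Finset.sum_range_succ, map_add, ih]
        simp only [G, Function.iterate_succ_apply']
        ring
    -- The `i`-th term has weight at least `i`, so only terms with `i` at most the weight of `d`
    -- contribute to the coefficient at `d`.
    let F : MvPowerSeries σ R := fun d => ∑ i ∈ Finset.range (Finsupp.weight w d + 1), coeff d (G i)
    have hF : ∀ n, F - ∑ i ∈ Finset.range n, G i ∈ weightIdeal R w n := by
      intro n d hd
      have e : coeff d F = ∑ i ∈ Finset.range (Finsupp.weight w d + 1), coeff d (G i) := rfl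
      rw [map_sub, map_sum, e, sub_eq_zero]
      refine Finset.sum_subset (Finset.range_subset_range.2 hd) fun i _ hi => ?_
      exact hG i d (by rw [Finset.mem_range] at hi; omega)
    refine ⟨F, sub_eq_zero.mp (eq_zero_of_forall_mem_weightIdeal (w := w) fun n => ?_)⟩
    have h1 := hL' n _ (hF n)
    rw [map_sub, hsum n] at h1
    have := Ideal.sub_mem _ h1 (hG n)
    convert this using 1
    ring

/-- Substitution of series that agree with the variables up to terms of higher weight,
as an automorphism of the power series ring. -/
noncomputable def substAlgEquiv {w : σ → ℕ} {a : σ → MvPowerSeries σ R}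
    (hs : HasSubst a) (ha : ∀ s, a s - X s ∈ weightIdeal R w (w s + 1)) :
    MvPowerSeries σ R ≃ₐ[R] MvPowerSeries σ R :=
  AlgEquiv.ofBijective (substAlgHom hs)
    (bijective_of_sub_mem_weightIdeal (w := w) (substAlgHom (R := R) hs).toLinearMap
      fun n f hf => by
        simpa only [AlgHom.toLinearMap_apply, substAlgHom_apply] using
          subst_sub_mem_weightIdeal hs ha hf)

theorem substAlgEquiv_apply {w : σ → ℕ} {a : σ → MvPowerSeries σ R}
    (hs : HasSubst a) (ha : ∀ s, a s - X s ∈ weightIdeal R w (w s + 1)) (f : MvPowerSeries σ R) :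
    substAlgEquiv hs ha f = subst a f := by
  rw [← substAlgHom_apply hs]; rfl

theorem pderiv_mem_weightIdeal {w : σ → ℕ} {n : ℕ} {f : MvPowerSeries σ R}
    (hf : f ∈ weightIdeal R w n) (s : σ) : pderiv R s f ∈ weightIdeal R w (n - w s) := by
  classical
  intro d hd
  rw [coeff_pderiv, hf _ (by rw [map_add, Finsupp.weight_single, one_smul]; omega), zero_mul]

/-- This stands in for continuity: maps out of the power series ring are compared by peeling off one
variable at a time, each gaining one order of precision. -/
theorem exists_eq_C_add_X_mul (f : MvPowerSeries (Fin 2) R) :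
    ∃ (c : R) (g : Fin 2 → MvPowerSeries (Fin 2) R), f = C c + ∑ i, X i * g i := by
  classical
  -- The part of `f` free of the first variable.
  let f₀ : MvPowerSeries (Fin 2) R := fun d => if d 0 = 0 then coeff d f else 0
  have hf₀ : ∀ d, coeff d f₀ = if d 0 = 0 then coeff d f else 0 := fun d => rfl
  have h0 : (X 0 : MvPowerSeries (Fin 2) R) ∣ f - f₀ :=
    X_dvd_iff.mpr fun m hm => by rw [map_sub, hf₀, if_pos hm, sub_self]
  have h1 : (X 1 : MvPowerSeries (Fin 2) R) ∣ f₀ - C (constantCoeff f) := by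
    refine X_dvd_iff.mpr fun m hm => ?_
    rw [map_sub, hf₀, coeff_C]
    by_cases h : m 0 = 0
    · have : m = 0 := by
        ext i
        fin_cases i
        · exact h
        · exact hm
      subst this
      simp
    · have : m ≠ 0 := fun h' => h (by rw [h']; rfl)
      simp [h, this]
  obtain ⟨u, hu⟩ := h0
  obtain ⟨v, hv⟩ := h1
  refine ⟨constantCoeff f, ![u, v], ?_⟩
  simp only [Fin.sum_univ_two, Matrix.cons_val_zero, Matrix.cons_val_one]
  rw [← hu, ← hv]
  ring

end MvPowerSeries

/-! ### Truncated exponentials of derivations in characteristic `p`. -/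

/-- A product of two truncated series is a sum over a square, the truncated series of the product a
sum over a triangle; the difference consists of the indices with `i + j ≥ p`. -/
theorem Finset.sum_range_sum_range_sub_mem {K M : Type*} [Ring K] [AddCommGroup M] [Module K M]
    (N : Submodule K M) (p : ℕ) (S : ℕ → ℕ → M) (h : ∀ i j, p ≤ i + j → S i j ∈ N) :
    ∑ i ∈ range p, ∑ j ∈ range p, S i j - ∑ n ∈ range p, ∑ x ∈ HasAntidiagonal.antidiagonal n, S x.1 x.2 ∈ N := by
  classical
  set s := (range p ×ˢ range p).filter (fun x => x.1 + x.2 < p) with hs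
  have h1 : ∑ n ∈ range p, ∑ x ∈ HasAntidiagonal.antidiagonal n, S x.1 x.2 = ∑ x ∈ s, S x.1 x.2 := by
    rw [← sum_fiberwise_of_maps_to (s := s) (t := range p) (g := fun x => x.1 + x.2)
      (fun x hx => mem_range.mpr (mem_filter.mp hx).2)]
    refine sum_congr rfl fun n hn => sum_congr ?_ fun _ _ => rfl
    ext x
    simp only [hs, mem_filter, mem_product, mem_range, HasAntidiagonal.mem_antidiagonal] at hn ⊢
    omega
  rw [h1, ← sum_product', ← sum_filter_add_sum_filter_not _ (fun x : ℕ × ℕ => x.1 + x.2 < p),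
    ← hs, add_sub_cancel_left]
  exact Submodule.sum_mem _ fun x hx => h _ _ (not_lt.mp (mem_filter.mp hx).2)

section TruncatedExponential

variable {K : Type*} [Field K]

/-- The exponential series of an endomorphism, truncated at degree `p`. -/
noncomputable def truncExp {M : Type*} [AddCommGroup M] [Module K M] (p : ℕ) (D : Module.End K M) :
    Module.End K M :=
  ∑ n ∈ Finset.range p, (n.factorial : K)⁻¹ • D ^ n

theorem truncExp_apply {M : Type*} [AddCommGroup M] [Module K M] (p : ℕ) (D : Module.End K M)
    (f : M) : truncExp p D f = ∑ n ∈ Finset.range p, (n.factorial : K)⁻¹ • (D ^ n) f := by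
  simp [truncExp]

theorem factorial_cast_ne_zero {p : ℕ} [hp : Fact p.Prime] [CharP K p] {n : ℕ} (h : n < p) :
    (n.factorial : K) ≠ 0 := by
  rw [Ne, CharP.cast_eq_zero_iff K p, hp.out.dvd_factorial]
  exact not_le.mpr h

theorem inv_factorial_mul_choose {p : ℕ} [Fact p.Prime] [CharP K p] {n : ℕ} (h : n < p)
    {x : ℕ × ℕ} (hx : x ∈ Finset.HasAntidiagonal.antidiagonal n) :
    (n.factorial : K)⁻¹ * (n.choose x.1 : K) = (x.1.factorial : K)⁻¹ * (x.2.factorial : K)⁻¹ := by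
  rw [Finset.HasAntidiagonal.mem_antidiagonal] at hx
  have h0 := factorial_cast_ne_zero (K := K) (p := p) h
  have h1 := factorial_cast_ne_zero (K := K) (p := p) (n := x.1) (by omega)
  have h2 := factorial_cast_ne_zero (K := K) (p := p) (n := x.2) (by omega)
  have h3 : ((x.1 + x.2).choose x.1 * x.1.factorial * x.2.factorial : ℕ) = (x.1 + x.2).factorial := by
    rw [Nat.choose_symm_add]
    exact Nat.add_choose_mul_factorial_mul_factorial _ _
  rw [hx] at h3
  have h4 : (n.choose x.1 : K) * x.1.factorial * x.2.factorial = n.factorial := by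
    rw [← h3]; push_cast; ring
  field_simp
  linear_combination h4

theorem Derivation.pow_apply_mul {R : Type*} [CommRing R] [Algebra K R] (D : Derivation K R R)
    (n : ℕ) (f g : R) :
    ((D : Module.End K R) ^ n) (f * g) = ∑ x ∈ Finset.HasAntidiagonal.antidiagonal n,
      n.choose x.1 • (((D : Module.End K R) ^ x.1) f * ((D : Module.End K R) ^ x.2) g) := by
  induction n with
  | zero => simp
  | succ n ih =>
    rw [Finset.sum_antidiagonal_choose_succ_nsmul
      (fun i j => ((D : Module.End K R) ^ i) f * ((D : Module.End K R) ^ j) g),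
      pow_succ', Module.End.mul_apply, ih, map_sum, ← Finset.sum_add_distrib]
    refine Finset.sum_congr rfl fun x hx => ?_
    rw [Finset.HasAntidiagonal.mem_antidiagonal] at hx
    have hc : n.choose x.2 = n.choose x.1 := by
      rw [← hx, Nat.choose_symm_add]
    rw [hc, ← smul_add, map_nsmul, pow_succ', pow_succ', Module.End.mul_apply, Module.End.mul_apply,
      Derivation.coeFn_coe, Derivation.leibniz]
    simp only [smul_eq_mul]
    congr 1
    ring

/-- A multiplicative descending filtration of a ring by ideals together with a derivation that
raises degrees. -/
structure RaisesFiltration {R : Type*} [CommRing R] [Algebra K R] (I : ℕ → Ideal R)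
    (D : Derivation K R R) : Prop where
  antitone : Antitone I
  mem_zero : ∀ f, f ∈ I 0
  mul_mem : ∀ {m n f g}, f ∈ I m → g ∈ I n → f * g ∈ I (m + n)
  map_mem : ∀ {n f}, f ∈ I n → D f ∈ I (n + 1)

namespace RaisesFiltration

variable {R : Type*} [CommRing R] [Algebra K R] {I : ℕ → Ideal R} {D : Derivation K R R}

theorem pow_mem (h : RaisesFiltration I D) {n : ℕ} {f : R} (hf : f ∈ I n) (i : ℕ) :
    ((D : Module.End K R) ^ i) f ∈ I (n + i) := by
  induction i with
  | zero => simpa using hf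
  | succ i ih =>
    rw [pow_succ', Module.End.mul_apply]
    exact h.map_mem ih

theorem truncExp_sub_mem (h : RaisesFiltration I D) {p : ℕ} (hp : 0 < p) {n : ℕ} {f : R}
    (hf : f ∈ I n) : truncExp p (D : Module.End K R) f - f ∈ I (n + 1) := by
  obtain ⟨q, rfl⟩ : ∃ q, p = q + 1 := ⟨p - 1, by omega⟩
  rw [truncExp_apply, Finset.sum_range_succ']
  simp only [pow_zero, Nat.factorial_zero, Nat.cast_one, inv_one, one_smul, Module.End.one_apply,
    add_sub_cancel_right]
  refine Submodule.sum_mem _ fun i _ => ?_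
  exact Submodule.smul_of_tower_mem _ _ (h.antitone (by omega) (h.pow_mem hf (i + 1)))

theorem truncExp_mem (h : RaisesFiltration I D) {p : ℕ} {n : ℕ} {f : R}
    (hf : f ∈ I n) : truncExp p (D : Module.End K R) f ∈ I n := by
  rw [truncExp_apply]
  refine Submodule.sum_mem _ fun i _ => ?_
  exact Submodule.smul_of_tower_mem _ _ (h.antitone (by omega) (h.pow_mem hf i))

/-- By the Leibniz rule the truncated exponential is multiplicative in total degree below `p`; the
remaining products `D^i f * D^j g` with `i + j ≥ p` lie in `I p`. -/
theorem truncExp_mul_sub_mem (h : RaisesFiltration I D) {p : ℕ} [Fact p.Prime] [CharP K p]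
    (f g : R) : truncExp p (D : Module.End K R) f * truncExp p (D : Module.End K R) g
      - truncExp p (D : Module.End K R) (f * g) ∈ I p := by
  have key := Finset.sum_range_sum_range_sub_mem ((I p).restrictScalars K) p
    (fun i j => ((i.factorial : K)⁻¹ • ((D : Module.End K R) ^ i) f) *
      ((j.factorial : K)⁻¹ • ((D : Module.End K R) ^ j) g)) (fun i j hij => by
        refine h.antitone hij (h.mul_mem ?_ ?_)
        · exact Submodule.smul_of_tower_mem _ _ (by simpa using h.pow_mem (h.mem_zero f) i)
        · exact Submodule.smul_of_tower_mem _ _ (by simpa using h.pow_mem (h.mem_zero g) j))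
  rw [Submodule.restrictScalars_mem] at key
  convert key using 2
  · rw [truncExp_apply, truncExp_apply, Finset.sum_mul_sum]
  · rw [truncExp_apply]
    refine Finset.sum_congr rfl fun n hn => ?_
    rw [D.pow_apply_mul, Finset.smul_sum]
    refine Finset.sum_congr rfl fun x hx => ?_
    rw [smul_mul_smul_comm, ← inv_factorial_mul_choose (K := K) (Finset.mem_range.mp hn) hx,
      mul_smul, Nat.cast_smul_eq_nsmul]

/-- An algebra homomorphism that agrees with the truncated exponential of a derivation on
generators of the augmentation ideal agrees with it up to high filtration degree. -/
theorem algHom_sub_truncExp_mem (h : RaisesFiltration I D) {p : ℕ} [Fact p.Prime] [CharP K p]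
    {ι : Type*} [Fintype ι] (x : ι → R) (hx : ∀ i, x i ∈ I 1)
    (hdec : ∀ f : R, ∃ (c : K) (g : ι → R), f = algebraMap K R c + ∑ i, x i * g i)
    (l : R →ₐ[K] R) (hl : ∀ i, l (x i) = truncExp p (D : Module.End K R) (x i)) (f : R) :
    l f - truncExp p (D : Module.End K R) f ∈ I p := by
  have hp : 0 < p := (Fact.out : p.Prime).pos
  have hC : ∀ c : K, truncExp p (D : Module.End K R) (algebraMap K R c) = algebraMap K R c := by
    intro c
    obtain ⟨q, rfl⟩ : ∃ q, p = q + 1 := ⟨p - 1, by omega⟩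
    rw [truncExp_apply, Finset.sum_range_succ']
    simp [pow_succ]
  -- Each generator peeled off lies in `I 1` and improves the agreement by one, until the failure of
  -- multiplicativity, of degree `p`, stops the gain.
  have key : ∀ N, ∀ f : R, l f - truncExp p (D : Module.End K R) f ∈ I (min N p) := by
    intro N
    induction N with
    | zero => exact fun f => by simpa using h.mem_zero _
    | succ N ih =>
      intro f
      obtain ⟨c, g, rfl⟩ := hdec f
      have e : l (algebraMap K R c + ∑ i, x i * g i) -
          truncExp p (D : Module.End K R) (algebraMap K R c + ∑ i, x i * g i) =
          ∑ i, (truncExp p (D : Module.End K R) (x i) *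
              (l (g i) - truncExp p (D : Module.End K R) (g i)) +
            (truncExp p (D : Module.End K R) (x i) * truncExp p (D : Module.End K R) (g i) -
              truncExp p (D : Module.End K R) (x i * g i))) := by
        simp only [map_add, map_sum, hC, AlgHom.commutes, map_mul, hl]
        rw [add_sub_add_left_eq_sub, ← Finset.sum_sub_distrib]
        exact Finset.sum_congr rfl fun i _ => by ring
      rw [e]
      refine Submodule.sum_mem _ fun i _ => Ideal.add_mem _ ?_ ?_
      · exact h.antitone (by omega) (h.mul_mem (h.truncExp_mem (hx i)) (ih (g i)))
      · exact h.antitone (by omega) (h.truncExp_mul_sub_mem (x i) (g i))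
  simpa using key p f

end RaisesFiltration

end TruncatedExponential

/-! ### Automorphisms of `K⟦t⟧`: orders and the chain rule. -/

namespace PowerSeries

variable {K : Type*} [Field K]

theorem eq_zero_of_forall_X_pow_dvd {f : K⟦X⟧} (h : ∀ n, X ^ n ∣ f) : f = 0 := by
  ext n
  rw [X_pow_dvd_iff.mp (h (n + 1)) n (Nat.lt_succ_self n), map_zero]

theorem exists_eq_C_add_X_mul (f : K⟦X⟧) : ∃ (c : K) (g : K⟦X⟧), f = C c + X * g :=
  ⟨_, _, f.eq_X_mul_shift_add_const.trans (add_comm _ _)⟩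

theorem algEquiv_C (r : K⟦X⟧ ≃ₐ[K] K⟦X⟧) (c : K) : r (C c) = C c := r.commutes c

/-- Automorphisms are not assumed continuous; they are local because an automorphism reflects units.
-/
theorem X_dvd_algEquiv_X (r : K⟦X⟧ ≃ₐ[K] K⟦X⟧) : X ∣ r X := by
  rw [X_dvd_iff]
  by_contra h
  have h1 : IsUnit (r X) := isUnit_iff_constantCoeff.mpr (isUnit_iff_ne_zero.mpr h)
  have h2 : IsUnit (X : K⟦X⟧) := by simpa using h1.map r.symm
  exact X_prime.not_isUnit h2

theorem X_pow_dvd_algEquiv (r : K⟦X⟧ ≃ₐ[K] K⟦X⟧) {n : ℕ} {f : K⟦X⟧} (h : X ^ n ∣ f) :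
    X ^ n ∣ r f := by
  obtain ⟨g, rfl⟩ := h
  rw [map_mul, map_pow]
  exact Dvd.dvd.mul_right (pow_dvd_pow_of_dvd (X_dvd_algEquiv_X r) n) _

theorem X_pow_dvd_algEquiv_iff (r : K⟦X⟧ ≃ₐ[K] K⟦X⟧) {n : ℕ} {f : K⟦X⟧} :
    X ^ n ∣ r f ↔ X ^ n ∣ f :=
  ⟨fun h => by simpa using X_pow_dvd_algEquiv r.symm h, X_pow_dvd_algEquiv r⟩

theorem order_eq_natCast_iff {f : K⟦X⟧} {n : ℕ} :
    order f = n ↔ X ^ n ∣ f ∧ ¬ X ^ (n + 1) ∣ f := by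
  rw [order_eq_nat, X_pow_dvd_iff, X_pow_dvd_iff]
  constructor
  · exact fun h => ⟨h.2, fun h' => h.1 (h' n (Nat.lt_succ_self n))⟩
  · refine fun h => ⟨fun h0 => h.2 fun m hm => ?_, h.1⟩
    rcases Nat.lt_succ_iff_lt_or_eq.mp hm with h' | rfl
    · exact h.1 m h'
    · exact h0

theorem order_algEquiv_eq_iff (r : K⟦X⟧ ≃ₐ[K] K⟦X⟧) {f : K⟦X⟧} {n : ℕ} :
    order (r f) = n ↔ order f = n := by
  rw [order_eq_natCast_iff, order_eq_natCast_iff, X_pow_dvd_algEquiv_iff, X_pow_dvd_algEquiv_iff]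

theorem derivative_algEquiv (r : K⟦X⟧ ≃ₐ[K] K⟦X⟧) (f : K⟦X⟧) :
    derivative K (r f) = r (derivative K f) * derivative K (r X) := by
  rw [← sub_eq_zero]
  refine eq_zero_of_forall_X_pow_dvd fun N => ?_
  induction N generalizing f with
  | zero => simp
  | succ N ih =>
    obtain ⟨c, g, rfl⟩ := exists_eq_C_add_X_mul f
    have e : derivative K (r (C c + X * g)) -
        r (derivative K (C c + X * g)) * derivative K (r X) =
        r X * (derivative K (r g) - r (derivative K g) * derivative K (r X)) := by
      simp only [map_add, map_mul, algEquiv_C, derivative_C, Derivation.leibniz, smul_eq_mul,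
        derivative_X, map_zero, map_one]
      ring
    rw [e, pow_succ']
    exact mul_dvd_mul (X_dvd_algEquiv_X r) (ih g)

/-- Otherwise `t^2` would divide `r t`, hence `t` itself. -/
theorem isUnit_derivative_algEquiv_X (r : K⟦X⟧ ≃ₐ[K] K⟦X⟧) : IsUnit (derivative K (r X)) := by
  rw [isUnit_iff_constantCoeff, isUnit_iff_ne_zero, ← coeff_zero_eq_constantCoeff_apply,
    coeff_derivative]
  intro h
  have h1 : coeff 1 (r X) = 0 := by simpa using h
  have h2 : (X : K⟦X⟧) ^ 2 ∣ r X := by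
    rw [X_pow_dvd_iff]
    intro m hm
    interval_cases m
    · simpa using X_dvd_iff.mp (X_dvd_algEquiv_X r)
    · exact h1
  rw [X_pow_dvd_algEquiv_iff, X_pow_dvd_iff] at h2
  simpa using h2 1 (by norm_num)

end PowerSeries

/-! ### Equivalence of parametrizations and invariance of `Γ` and `Λ`. -/

namespace PlaneParametrization

variable {K : Type*} [Field K]

theorem X_dvd_x (ψ : PlaneParametrization K) : PowerSeries.X ∣ ψ.x :=
  PowerSeries.X_dvd_iff.mpr ψ.constantCoeff_x

theorem X_dvd_y (ψ : PlaneParametrization K) : PowerSeries.X ∣ ψ.y :=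
  PowerSeries.X_dvd_iff.mpr ψ.constantCoeff_y

theorem toAlgHom_C (ψ : PlaneParametrization K) (c : K) :
    ψ.toAlgHom (MvPowerSeries.C c) = PowerSeries.C c := ψ.toAlgHom.commutes c

theorem algHom_ext_of_X_dvd {f g : MvPowerSeries (Fin 2) K →ₐ[K] K⟦X⟧}
    (h : ∀ i, f (MvPowerSeries.X i) = g (MvPowerSeries.X i))
    (hX : ∀ i, PowerSeries.X ∣ f (MvPowerSeries.X i)) : f = g := by
  ext1 u
  rw [← sub_eq_zero]
  refine PowerSeries.eq_zero_of_forall_X_pow_dvd fun N => ?_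
  induction N generalizing u with
  | zero => simp
  | succ N ih =>
    obtain ⟨c, v, rfl⟩ := MvPowerSeries.exists_eq_C_add_X_mul u
    have hf : f (MvPowerSeries.C c) = g (MvPowerSeries.C c) :=
      (f.commutes c).trans (g.commutes c).symm
    have e : f (MvPowerSeries.C c + ∑ i, MvPowerSeries.X i * v i) -
        g (MvPowerSeries.C c + ∑ i, MvPowerSeries.X i * v i) =
        ∑ i, f (MvPowerSeries.X i) * (f (v i) - g (v i)) := by
      simp only [map_add, map_sum, map_mul, hf, ← h, mul_sub, Finset.sum_sub_distrib]
      ring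
    rw [e, pow_succ']
    exact Finset.dvd_sum fun i _ => mul_dvd_mul (hX i) (ih (v i))

theorem AEquiv.of_generators {ψ φ : PlaneParametrization K}
    (l : MvPowerSeries (Fin 2) K ≃ₐ[K] MvPowerSeries (Fin 2) K) (r : K⟦X⟧ ≃ₐ[K] K⟦X⟧)
    (hx : φ.x = r (ψ.toAlgHom (l (MvPowerSeries.X 0))))
    (hy : φ.y = r (ψ.toAlgHom (l (MvPowerSeries.X 1)))) : ψ.AEquiv φ := by
  refine ⟨l, r, algHom_ext_of_X_dvd (fun i => ?_) fun i => ?_⟩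
  · fin_cases i
    · exact φ.toAlgHom_X_zero.trans hx
    · exact φ.toAlgHom_X_one.trans hy
  · fin_cases i
    · exact φ.toAlgHom_X_zero.symm ▸ φ.X_dvd_x
    · exact φ.toAlgHom_X_one.symm ▸ φ.X_dvd_y

theorem AEquiv.toAlgHom_eq {ψ φ : PlaneParametrization K} (h : ψ.AEquiv φ) :
    ∃ (l : MvPowerSeries (Fin 2) K ≃ₐ[K] MvPowerSeries (Fin 2) K) (r : K⟦X⟧ ≃ₐ[K] K⟦X⟧),
      ∀ f, φ.toAlgHom f = r (ψ.toAlgHom (l f)) := by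
  obtain ⟨l, r, h⟩ := h
  exact ⟨l, r, fun f => by rw [h]; rfl⟩

theorem AEquiv.of_toAlgHom_eq {ψ φ : PlaneParametrization K}
    (l : MvPowerSeries (Fin 2) K ≃ₐ[K] MvPowerSeries (Fin 2) K) (r : K⟦X⟧ ≃ₐ[K] K⟦X⟧)
    (h : ∀ f, φ.toAlgHom f = r (ψ.toAlgHom (l f))) : ψ.AEquiv φ :=
  ⟨l, r, AlgHom.ext h⟩

theorem AEquiv.refl (ψ : PlaneParametrization K) : ψ.AEquiv ψ :=
  .of_toAlgHom_eq AlgEquiv.refl AlgEquiv.refl fun _ => rfl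

theorem AEquiv.symm {ψ φ : PlaneParametrization K} (h : ψ.AEquiv φ) : φ.AEquiv ψ := by
  obtain ⟨l, r, h⟩ := h.toAlgHom_eq
  exact .of_toAlgHom_eq l.symm r.symm fun f => by simp [h]

theorem AEquiv.trans {ψ φ χ : PlaneParametrization K} (h : ψ.AEquiv φ) (h' : φ.AEquiv χ) :
    ψ.AEquiv χ := by
  obtain ⟨l, r, h⟩ := h.toAlgHom_eq
  obtain ⟨l', r', h'⟩ := h'.toAlgHom_eq
  exact .of_toAlgHom_eq (l'.trans l) (r.trans r') fun f => by simp [h, h']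

theorem derivative_toAlgHom (ψ : PlaneParametrization K) (f : MvPowerSeries (Fin 2) K) :
    PowerSeries.derivative K (ψ.toAlgHom f) =
      ψ.toAlgHom (MvPowerSeries.pderiv K 0 f) * PowerSeries.derivative K ψ.x +
      ψ.toAlgHom (MvPowerSeries.pderiv K 1 f) * PowerSeries.derivative K ψ.y := by
  rw [← sub_eq_zero]
  refine PowerSeries.eq_zero_of_forall_X_pow_dvd fun N => ?_
  induction N generalizing f with
  | zero => simp
  | succ N ih =>
    obtain ⟨c, g, rfl⟩ := MvPowerSeries.exists_eq_C_add_X_mul f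
    have e : ∀ h, h = PowerSeries.derivative K (ψ.toAlgHom
          (MvPowerSeries.C c + ∑ i, MvPowerSeries.X i * g i)) -
        (ψ.toAlgHom (MvPowerSeries.pderiv K 0
          (MvPowerSeries.C c + ∑ i, MvPowerSeries.X i * g i)) * PowerSeries.derivative K ψ.x +
        ψ.toAlgHom (MvPowerSeries.pderiv K 1
          (MvPowerSeries.C c + ∑ i, MvPowerSeries.X i * g i)) * PowerSeries.derivative K ψ.y) →
        h = ψ.x * (PowerSeries.derivative K (ψ.toAlgHom (g 0)) -
          (ψ.toAlgHom (MvPowerSeries.pderiv K 0 (g 0)) * PowerSeries.derivative K ψ.x +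
          ψ.toAlgHom (MvPowerSeries.pderiv K 1 (g 0)) * PowerSeries.derivative K ψ.y)) +
        ψ.y * (PowerSeries.derivative K (ψ.toAlgHom (g 1)) -
          (ψ.toAlgHom (MvPowerSeries.pderiv K 0 (g 1)) * PowerSeries.derivative K ψ.x +
          ψ.toAlgHom (MvPowerSeries.pderiv K 1 (g 1)) * PowerSeries.derivative K ψ.y)) := by
      rintro h rfl
      simp only [Fin.sum_univ_two, map_add, map_mul, Derivation.leibniz, smul_eq_mul,
        MvPowerSeries.pderiv_C, toAlgHom_C, toAlgHom_X_zero, toAlgHom_X_one,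
        MvPowerSeries.pderiv_X, PowerSeries.derivative_C, map_zero]
      simp
      ring
    rw [e _ rfl, pow_succ']
    exact dvd_add (mul_dvd_mul ψ.X_dvd_x (ih _)) (mul_dvd_mul ψ.X_dvd_y (ih _))

theorem mem_differentials {ψ : PlaneParametrization K} {w : K⟦X⟧} :
    w ∈ ψ.differentials ↔ ∃ A B, w = ψ.toAlgHom A * PowerSeries.derivative K ψ.x +
      ψ.toAlgHom B * PowerSeries.derivative K ψ.y := by
  rw [differentials, Submodule.mem_span_pair]
  constructor
  · rintro ⟨⟨_, A, rfl⟩, ⟨_, B, rfl⟩, rfl⟩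
    exact ⟨A, B, rfl⟩
  · rintro ⟨A, B, rfl⟩
    exact ⟨⟨_, A, rfl⟩, ⟨_, B, rfl⟩, rfl⟩

theorem derivative_mem_differentials (ψ : PlaneParametrization K) (f : MvPowerSeries (Fin 2) K) :
    PowerSeries.derivative K (ψ.toAlgHom f) ∈ ψ.differentials :=
  mem_differentials.mpr ⟨_, _, ψ.derivative_toAlgHom f⟩

theorem toAlgHom_mul_mem_differentials (ψ : PlaneParametrization K) (f : MvPowerSeries (Fin 2) K)
    {w : K⟦X⟧} (hw : w ∈ ψ.differentials) : ψ.toAlgHom f * w ∈ ψ.differentials :=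
  ψ.differentials.smul_mem (⟨_, f, rfl⟩ : ψ.ring) hw

/-- The series of order at least `c` all lie in the local ring of the branch. -/
def ContainsOrder (ψ : PlaneParametrization K) (c : ℕ) : Prop :=
  ∀ f : K⟦X⟧, PowerSeries.X ^ c ∣ f → f ∈ ψ.ring

namespace AEquiv

variable {ψ φ : PlaneParametrization K}

theorem semigroup_subset (h : ψ.AEquiv φ) : φ.semigroup ⊆ ψ.semigroup := by
  obtain ⟨l, r, h⟩ := h.toAlgHom_eq
  rintro n ⟨_, ⟨f, rfl⟩, hn⟩
  refine ⟨_, ⟨l f, rfl⟩, ?_⟩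
  rw [← PowerSeries.order_algEquiv_eq_iff r]
  exact (h f) ▸ hn

/-- By the chain rule a differential of `φ` is `r` of a differential of `ψ`, times the unit `(r
t)'`; neither operation changes orders. -/
theorem semimodule_subset (h : ψ.AEquiv φ) : φ.semimodule ⊆ ψ.semimodule := by
  obtain ⟨l, r, h⟩ := h.toAlgHom_eq
  have hd : ∀ f, PowerSeries.derivative K (φ.toAlgHom f) =
      r (PowerSeries.derivative K (ψ.toAlgHom (l f))) *
        PowerSeries.derivative K (r PowerSeries.X) := fun f => by
    rw [h, PowerSeries.derivative_algEquiv]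
  rintro s (⟨w, hw, n, hn, rfl⟩ | hs)
  · obtain ⟨A, B, rfl⟩ := mem_differentials.mp hw
    refine Or.inl ⟨_, Submodule.add_mem _
      (ψ.toAlgHom_mul_mem_differentials (l A) (ψ.derivative_mem_differentials (l (.X 0))))
      (ψ.toAlgHom_mul_mem_differentials (l B) (ψ.derivative_mem_differentials (l (.X 1)))),
      n, ?_, rfl⟩
    rw [← PowerSeries.order_algEquiv_eq_iff r, ← hn]
    have hu := PowerSeries.order_zero_of_unit (PowerSeries.isUnit_derivative_algEquiv_X r)
    conv_rhs => rw [← toAlgHom_X_zero, ← toAlgHom_X_one, hd, hd, h, h, ← mul_assoc, ← mul_assoc,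
      ← add_mul, PowerSeries.order_mul, hu, add_zero]
    rw [map_add, map_mul, map_mul]
  · exact Or.inr hs

theorem semigroup_eq (h : ψ.AEquiv φ) : φ.semigroup = ψ.semigroup :=
  h.semigroup_subset.antisymm h.symm.semigroup_subset

theorem semimodule_eq (h : ψ.AEquiv φ) : φ.semimodule = ψ.semimodule :=
  h.semimodule_subset.antisymm h.symm.semimodule_subset

theorem containsOrder (h : ψ.AEquiv φ) {c : ℕ} (hc : ψ.ContainsOrder c) : φ.ContainsOrder c := by
  obtain ⟨l, r, h⟩ := h.toAlgHom_eq
  intro f hf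
  obtain ⟨g, hg⟩ := hc _ (PowerSeries.X_pow_dvd_algEquiv r.symm hf)
  refine ⟨l.symm g, ?_⟩
  have e : φ.toAlgHom (l.symm g) = f := by
    rw [h, l.apply_symm_apply]
    exact (congrArg r hg).trans (r.apply_symm_apply f)
  exact e

end AEquiv

end PlaneParametrization

/-! ### Coefficients along a branch close to `(t^a, t^b)`. -/

namespace PowerSeries

variable {K : Type*} [Field K]

theorem coeff_X_pow_mul_of_dvd_sub_C {s m n : ℕ} {w : K⟦X⟧} {c : K} (hw : X ^ m ∣ w - C c)
    (hn : n < s + m) : coeff n (X ^ s * w) = if n = s then c else 0 := by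
  rw [coeff_X_pow_mul']
  have hc : ∀ j < m, coeff j w = if j = 0 then c else 0 := fun j hj => by
    have := X_pow_dvd_iff.mp hw j hj
    rw [map_sub, coeff_C, sub_eq_zero] at this
    exact this
  split_ifs with h1 h2 h2
  · subst h2
    rw [hc _ (by omega), Nat.sub_self, if_pos rfl]
  · rw [hc _ (by omega), if_neg (by omega)]
  · omega
  · rfl

end PowerSeries

namespace PlaneParametrization

open PowerSeries in
/-- The parametrization `(t^a, y)` has `y` equal to `t^b` up to terms of order at least `k > b`. -/
structure IsClose {K : Type*} [Field K] (ψ : PlaneParametrization K) (a b k : ℕ) : Prop where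
  pos : 0 < a
  lt_right : a < b
  lt_bound : b < k
  x_eq : ψ.x = X ^ a
  y_sub : X ^ k ∣ ψ.y - X ^ b

variable {K : Type*} [Field K]

section Extraction

open PowerSeries

/-- The extra factor `u` is there so that the same expansion serves functions (`u = 1`) and both
halves of a differential (`u = x` and `u = t y'`). -/
theorem coeff_toAlgHom_mul (ψ : PlaneParametrization K) (f : MvPowerSeries (Fin 2) K) (u : K⟦X⟧)
    (n : ℕ) : coeff n (ψ.toAlgHom f * u) =
      ∑ᶠ d : Fin 2 →₀ ℕ, MvPowerSeries.coeff d f * coeff n (ψ.x ^ d 0 * ψ.y ^ d 1 * u) := by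
  have hprod : ∀ d : Fin 2 →₀ ℕ, (d.prod fun s e => (![ψ.x, ψ.y] s) ^ e) =
      ψ.x ^ d 0 * ψ.y ^ d 1 := fun d => by
    rw [Finsupp.prod_fintype _ _ (fun i => pow_zero _)]
    simp
  have h1 : ∀ i, coeff i (ψ.toAlgHom f) =
      ∑ᶠ d : Fin 2 →₀ ℕ, MvPowerSeries.coeff d f * coeff i (ψ.x ^ d 0 * ψ.y ^ d 1) := fun i => by
    have := MvPowerSeries.coeff_subst ψ.hasSubst f (Finsupp.single () i)
    simp only [hprod, smul_eq_mul] at this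
    rw [← MvPowerSeries.substAlgHom_apply ψ.hasSubst] at this
    exact this
  have hfin : ∀ i, (Function.support fun d : Fin 2 →₀ ℕ =>
      MvPowerSeries.coeff d f * coeff i (ψ.x ^ d 0 * ψ.y ^ d 1)).Finite := fun i => by
    have := MvPowerSeries.coeff_subst_finite ψ.hasSubst f (Finsupp.single () i)
    simp only [hprod, smul_eq_mul] at this
    exact this
  rw [coeff_mul]
  simp only [h1]
  have h2 : ∀ x : ℕ × ℕ, (∑ᶠ d : Fin 2 →₀ ℕ,
      MvPowerSeries.coeff d f * coeff x.1 (ψ.x ^ d 0 * ψ.y ^ d 1)) * coeff x.2 u =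
      ∑ᶠ d : Fin 2 →₀ ℕ,
      MvPowerSeries.coeff d f * coeff x.1 (ψ.x ^ d 0 * ψ.y ^ d 1) * coeff x.2 u :=
    fun x => finsum_mul' _ _ (hfin x.1)
  simp only [h2]
  rw [← finsum_sum_comm]
  · refine finsum_congr fun d => ?_
    rw [coeff_mul, Finset.mul_sum]
    exact Finset.sum_congr rfl fun x _ => by ring
  · intro x _
    refine (hfin x.1).subset fun d hd h0 => hd ?_
    simp only at h0 ⊢
    rw [h0, zero_mul]

theorem coeff_toAlgHom_mul_eq_single (ψ : PlaneParametrization K) (f : MvPowerSeries (Fin 2) K)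
    (u : K⟦X⟧) (n : ℕ) (d₀ : Fin 2 →₀ ℕ) (h : ∀ d, d ≠ d₀ → MvPowerSeries.coeff d f ≠ 0 →
      coeff n (ψ.x ^ d 0 * ψ.y ^ d 1 * u) = 0) :
    coeff n (ψ.toAlgHom f * u) =
      MvPowerSeries.coeff d₀ f * coeff n (ψ.x ^ d₀ 0 * ψ.y ^ d₀ 1 * u) := by
  rw [coeff_toAlgHom_mul]
  refine finsum_eq_single _ d₀ fun d hd => ?_
  by_cases h0 : MvPowerSeries.coeff d f = 0
  · rw [h0, zero_mul]
  · rw [h d hd h0, mul_zero]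

theorem coeff_toAlgHom_mul_eq_zero (ψ : PlaneParametrization K) (f : MvPowerSeries (Fin 2) K)
    (u : K⟦X⟧) (n : ℕ) (h : ∀ d, MvPowerSeries.coeff d f ≠ 0 →
      coeff n (ψ.x ^ d 0 * ψ.y ^ d 1 * u) = 0) : coeff n (ψ.toAlgHom f * u) = 0 := by
  by_cases h0 : MvPowerSeries.coeff 0 f = 0
  · rw [coeff_toAlgHom_mul_eq_single ψ f u n 0 fun d _ hd => h d hd, h0, zero_mul]
  · rw [coeff_toAlgHom_mul_eq_single ψ f u n 0 fun d _ hd => h d hd, h 0 h0, mul_zero]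

theorem weight_pair (a b : ℕ) (d : Fin 2 →₀ ℕ) : Finsupp.weight ![a, b] d = a * d 0 + b * d 1 := by
  rw [Finsupp.weight_apply, Finsupp.sum_fintype _ _ (by simp)]
  simp [mul_comm]

theorem X_pow_dvd_toAlgHom {ψ : PlaneParametrization K} {a b n : ℕ} (hx : X ^ a ∣ ψ.x)
    (hy : X ^ b ∣ ψ.y) {f : MvPowerSeries (Fin 2) K}
    (hf : f ∈ MvPowerSeries.weightIdeal K ![a, b] n) : X ^ n ∣ ψ.toAlgHom f := by
  rw [X_pow_dvd_iff]
  intro m hm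
  rw [← mul_one (ψ.toAlgHom f)]
  refine coeff_toAlgHom_mul_eq_zero _ _ _ _ fun d hd => ?_
  have h1 : n ≤ a * d 0 + b * d 1 := by
    by_contra h
    exact hd (hf d (by rw [weight_pair]; omega))
  have h2 : (X : K⟦X⟧) ^ (a * d 0 + b * d 1) ∣ ψ.x ^ d 0 * ψ.y ^ d 1 := by
    rw [pow_add, pow_mul, pow_mul]
    exact mul_dvd_mul (pow_dvd_pow_of_dvd hx _) (pow_dvd_pow_of_dvd hy _)
  rw [mul_one]
  exact X_pow_dvd_iff.mp h2 m (by omega)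

namespace IsClose

variable {ψ : PlaneParametrization K} {a b k : ℕ}

theorem exists_y_eq (h : ψ.IsClose a b k) : ∃ v, ψ.y = X ^ b * v ∧ X ^ (k - b) ∣ v - 1 := by
  obtain ⟨q, hq⟩ := h.y_sub
  refine ⟨1 + X ^ (k - b) * q, ?_, ⟨q, by ring⟩⟩
  rw [mul_add, mul_one, ← mul_assoc, ← pow_add, Nat.add_sub_cancel' h.lt_bound.le, ← hq]
  ring

theorem X_pow_dvd_y (h : ψ.IsClose a b k) : X ^ b ∣ ψ.y := by
  obtain ⟨v, hv, -⟩ := h.exists_y_eq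
  exact ⟨v, hv⟩

/-- Writing `y = t^b v` with `v ≡ 1` modulo `t^(k - b)`, the monomial is `t^(ai + bj) v^j`, so
corrections start `k - b` orders later, and never if `j = 0`. -/
theorem coeff_mono (h : ψ.IsClose a b k) {n i j : ℕ} (hn : j = 0 ∨ n + b < a * i + b * j + k) :
    coeff n (ψ.x ^ i * ψ.y ^ j) = if n = a * i + b * j then 1 else 0 := by
  obtain ⟨v, hv, hv'⟩ := h.exists_y_eq
  have e : ψ.x ^ i * ψ.y ^ j = X ^ (a * i + b * j) * v ^ j := by
    rw [h.x_eq, hv]; ring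
  rw [e]
  rcases hn with rfl | hn
  · exact coeff_X_pow_mul_of_dvd_sub_C (m := n + 1) (by simp) (by omega)
  · refine coeff_X_pow_mul_of_dvd_sub_C (m := k - b) ?_ (by have := h.lt_bound; omega)
    rw [map_one, ← one_pow j]
    exact hv'.trans (sub_dvd_pow_sub_pow _ _ _)

theorem X_mul_derivative_sub (h : ψ.IsClose a b k) :
    X ^ k ∣ X * derivative K ψ.y - X ^ b * C (b : K) := by
  obtain ⟨q, hq⟩ := h.y_sub
  rw [sub_eq_iff_eq_add] at hq
  have hb : b = (b - 1) + 1 := by have := h.lt_right; omega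
  refine ⟨(k : K⟦X⟧) * q + X * derivative K q, ?_⟩
  rw [hq]
  have hk : k = (k - 1) + 1 := by have := h.lt_bound; omega
  simp only [map_add, Derivation.leibniz, Derivation.leibniz_pow, derivative_X, smul_eq_mul,
    nsmul_eq_mul, mul_one, map_natCast]
  have e1 : (X : K⟦X⟧) * X ^ (k - 1) = X ^ k := by rw [← pow_succ', ← hk]
  have e2 : (X : K⟦X⟧) * X ^ (b - 1) = X ^ b := by rw [← pow_succ', ← hb]
  linear_combination (k * q : K⟦X⟧) * e1 + (b : K⟦X⟧) * e2

theorem coeff_mono_mul_derivative (h : ψ.IsClose a b k) {n i j : ℕ} (hn : n < a * i + b * j + k) :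
    coeff n (ψ.x ^ i * ψ.y ^ j * (X * derivative K ψ.y)) =
      if n = a * i + b * (j + 1) then (b : K) else 0 := by
  obtain ⟨v, hv, hv'⟩ := h.exists_y_eq
  obtain ⟨q, hq⟩ := h.X_mul_derivative_sub
  have hkb : X ^ k = X ^ b * (X : K⟦X⟧) ^ (k - b) := by
    rw [← pow_add, Nat.add_sub_cancel' h.lt_bound.le]
  have e : ψ.x ^ i * ψ.y ^ j * (X * derivative K ψ.y) =
      X ^ (a * i + b * (j + 1)) * (v ^ j * (C (b : K) + X ^ (k - b) * q)) := by
    rw [sub_eq_iff_eq_add.mp hq, h.x_eq, hv, hkb]; ring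
  rw [e]
  refine coeff_X_pow_mul_of_dvd_sub_C (m := k - b) ?_
    (by have := h.lt_bound; rw [mul_add, mul_one]; omega)
  have hj : X ^ (k - b) ∣ v ^ j - 1 := by
    rw [← one_pow j]
    exact hv'.trans (sub_dvd_pow_sub_pow _ _ _)
  have e2 : v ^ j * (C (b : K) + X ^ (k - b) * q) - C (b : K) =
    (v ^ j - 1) * C (b : K) + X ^ (k - b) * (v ^ j * q) := by ring
  rw [e2]
  exact dvd_add (Dvd.dvd.mul_right hj _) (dvd_mul_right _ _)

/-- A series of order greater than `b` in the local ring comes from one of weight greater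
than `b`. -/
theorem mem_weightIdeal_of_dvd (h : ψ.IsClose a b k) (hdvd : ¬ a ∣ b)
    {g : MvPowerSeries (Fin 2) K} (hg : X ^ (b + 1) ∣ ψ.toAlgHom g) :
    g ∈ MvPowerSeries.weightIdeal K ![a, b] (b + 1) := by
  intro d₀ hd₀
  rw [weight_pair] at hd₀
  have ha := h.pos
  have hab := h.lt_right
  have hk := h.lt_bound
  -- The monomials of weight at most `b` are the powers of `x` and `y` itself. Since `a ∤ b`, their
  -- orders are distinct and nothing can cancel.
  have hu : ∀ d : Fin 2 →₀ ℕ, a * d 0 + b * d 1 ≤ b → d 1 = 0 ∨ (d 1 = 1 ∧ d 0 = 0) := by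
    intro d hd
    rcases Nat.lt_or_ge (d 1) 1 with h1 | h1
    · omega
    · right
      have h2 : d 1 = 1 := by
        by_contra h2
        have : b * 2 ≤ b * d 1 := Nat.mul_le_mul_left b (by omega)
        omega
      rw [h2] at hd
      refine ⟨h2, ?_⟩
      have : a * d 0 = 0 := by omega
      rcases Nat.mul_eq_zero.mp this with h3 | h3 <;> omega
  have key := coeff_toAlgHom_mul_eq_single ψ g 1 (a * d₀ 0 + b * d₀ 1) d₀ fun d hd _ => by
    rw [mul_one]
    rcases Nat.lt_or_ge (a * d₀ 0 + b * d₀ 1) (a * d 0 + b * d 1) with hlt | hge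
    · rw [h.coeff_mono (by omega), if_neg (by omega)]
    · rcases hu d (by omega) with h1 | ⟨h1, h2⟩
      · rw [h.coeff_mono (Or.inl h1), if_neg]
        intro h3
        rcases hu d₀ (by omega) with h4 | ⟨h4, h5⟩
        · rw [h1, h4] at h3
          refine hd ?_
          ext i
          fin_cases i
          · exact (Nat.eq_of_mul_eq_mul_left ha (by simpa using h3)).symm
          · exact h1.trans h4.symm
        · rw [h1, h4, h5] at h3
          exact hdvd ⟨d 0, by simpa using h3⟩
      · rw [h.coeff_mono (by rw [h1, h2]; right; omega), if_neg]
        intro h3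
        rw [h1, h2] at h3
        rcases hu d₀ (by omega) with h4 | ⟨h4, h5⟩
        · rw [h4] at h3
          exact hdvd ⟨d₀ 0, by simpa using h3.symm⟩
        · refine hd ?_
          ext i
          fin_cases i
          · exact h2.trans h5.symm
          · exact h1.trans h4.symm
  rw [mul_one, mul_one, X_pow_dvd_iff.mp hg _ hd₀, h.coeff_mono (by omega), if_pos rfl,
    mul_one] at key
  exact key.symm

end IsClose

end Extraction

/-! ### The conductor, and absorption of high-order terms. -/

section Conductor

theorem aeval_quotient_mk (ψ : PlaneParametrization K) (q : Polynomial K) (f : K⟦X⟧)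
    (T : Module.End K (K⟦X⟧ ⧸ Subalgebra.toSubmodule ψ.ring))
    (hT : ∀ f, T (Submodule.Quotient.mk f) = Submodule.Quotient.mk (ψ.x * f)) :
    Polynomial.aeval T q (Submodule.Quotient.mk f) =
      Submodule.Quotient.mk (Polynomial.aeval ψ.x q * f) := by
  induction q using Polynomial.induction_on generalizing f with
  | C c =>
    simp only [Polynomial.aeval_C, Module.algebraMap_end_apply]
    rw [← Submodule.Quotient.mk_smul, Algebra.smul_def]
  | add p q hp hq => simp only [map_add, LinearMap.add_apply, hp, hq, add_mul,
      Submodule.Quotient.mk_add]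
  | monomial n c ih =>
    rw [pow_succ, ← mul_assoc, map_mul (Polynomial.aeval T), Polynomial.aeval_X,
      Module.End.mul_apply, hT, ih, map_mul (Polynomial.aeval ψ.x) (_ * _), Polynomial.aeval_X,
      mul_assoc]

/-- Cayley–Hamilton for multiplication by `x` on the finite-dimensional quotient: the characteristic
polynomial is `T^m q(T)` with `q(0) ≠ 0`. As `q(x)` is a unit, `x^m = t^(am)` sends all of `K⟦t⟧`
into the local ring. -/
theorem IsPrimitive.exists_containsOrder {ψ : PlaneParametrization K} (hψ : ψ.IsPrimitive) {a : ℕ}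
    (hx : ψ.x = PowerSeries.X ^ a) : ∃ M, ψ.ContainsOrder M := by
  have : FiniteDimensional K (K⟦X⟧ ⧸ Subalgebra.toSubmodule ψ.ring) := hψ
  have hxmem : ψ.x ∈ ψ.ring := ⟨_, ψ.toAlgHom_X_zero⟩
  let T : Module.End K (K⟦X⟧ ⧸ Subalgebra.toSubmodule ψ.ring) :=
    Submodule.mapQ _ _ (LinearMap.mulLeft K ψ.x) fun f hf => ψ.ring.mul_mem hxmem hf
  have hT : ∀ f, T (Submodule.Quotient.mk f) = Submodule.Quotient.mk (ψ.x * f) := fun f => rfl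
  obtain ⟨q, hq, hq'⟩ := Polynomial.exists_eq_pow_rootMultiplicity_mul_and_not_dvd T.charpoly
    T.charpoly_monic.ne_zero 0
  set m := T.charpoly.rootMultiplicity 0
  have hmem : ∀ f : K⟦X⟧, ψ.x ^ m * (Polynomial.aeval ψ.x q * f) ∈ ψ.ring := by
    intro f
    have h1 := ψ.aeval_quotient_mk T.charpoly f T hT
    rw [LinearMap.aeval_self_charpoly, LinearMap.zero_apply, eq_comm,
      Submodule.Quotient.mk_eq_zero] at h1
    rw [hq] at h1
    simpa [mul_assoc] using h1
  have hunit : IsUnit (Polynomial.aeval (MvPowerSeries.X 0 : MvPowerSeries (Fin 2) K) q) := by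
    rw [MvPowerSeries.isUnit_iff_constantCoeff, isUnit_iff_ne_zero]
    intro h0
    apply hq'
    rw [map_zero, sub_zero, Polynomial.X_dvd_iff]
    have h2 := Polynomial.hom_eval₂ q (algebraMap K (MvPowerSeries (Fin 2) K))
      (MvPowerSeries.constantCoeff (σ := Fin 2) (R := K)) (MvPowerSeries.X 0)
    rw [← Polynomial.aeval_def, h0, MvPowerSeries.constantCoeff_X] at h2
    have h3 : (MvPowerSeries.constantCoeff (σ := Fin 2) (R := K)).comp
        (algebraMap K (MvPowerSeries (Fin 2) K)) = RingHom.id K := by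
      ext c
      simp [MvPowerSeries.algebraMap_apply]
    rw [h3] at h2
    rw [Polynomial.coeff_zero_eq_eval_zero, Polynomial.eval, ← h2]
  obtain ⟨v, hv⟩ := hunit.exists_right_inv
  have hv' : Polynomial.aeval ψ.x q * ψ.toAlgHom v = 1 := by
    have := congrArg ψ.toAlgHom hv
    rwa [map_mul, map_one, ← Polynomial.aeval_algHom_apply, ψ.toAlgHom_X_zero] at this
  refine ⟨a * m, ?_⟩
  rintro _ ⟨f, rfl⟩
  have h3 := hmem (ψ.toAlgHom v * f)
  rwa [← mul_assoc (Polynomial.aeval ψ.x q), hv', one_mul, hx, ← pow_mul] at h3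

theorem ContainsOrder.mono {ψ : PlaneParametrization K} {c d : ℕ} (h : ψ.ContainsOrder c)
    (hcd : c ≤ d) : ψ.ContainsOrder d := fun _ hf => h _ ((pow_dvd_pow _ hcd).trans hf)

theorem ContainsOrder.mem_semigroup {ψ : PlaneParametrization K} {c n : ℕ} (h : ψ.ContainsOrder c)
    (hn : c ≤ n) : n ∈ ψ.semigroup :=
  ⟨PowerSeries.X ^ n, h _ (pow_dvd_pow _ hn), PowerSeries.order_X_pow n⟩

theorem ContainsOrder.of_succ {ψ : PlaneParametrization K} {c : ℕ} (h : ψ.ContainsOrder (c + 1))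
    (hc : c ∈ ψ.semigroup) : ψ.ContainsOrder c := by
  obtain ⟨g, hg, hgc⟩ := hc
  intro f hf
  rw [PowerSeries.order_eq_nat] at hgc
  have h1 : f - (PowerSeries.coeff c f / PowerSeries.coeff c g) • g ∈ ψ.ring := by
    refine h _ (PowerSeries.X_pow_dvd_iff.mpr fun m hm => ?_)
    rw [map_sub, PowerSeries.coeff_smul, smul_eq_mul]
    rcases Nat.lt_succ_iff_lt_or_eq.mp hm with hm | rfl
    · rw [PowerSeries.X_pow_dvd_iff.mp hf m hm, hgc.2 m hm, mul_zero, sub_zero]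
    · rw [div_mul_cancel₀ _ hgc.1, sub_self]
  have := ψ.ring.add_mem h1 (ψ.ring.smul_mem hg (PowerSeries.coeff c f / PowerSeries.coeff c g))
  simpa using this

/-- Starting from any bound, an element of the local ring of each order `≥ c(Γ)` lowers the bound by
one. -/
theorem IsPrimitive.containsOrder_conductor {ψ : PlaneParametrization K} (hψ : ψ.IsPrimitive)
    {a : ℕ} (hx : ψ.x = PowerSeries.X ^ a) : ψ.ContainsOrder ψ.conductor := by
  obtain ⟨M, hM⟩ := hψ.exists_containsOrder hx
  have hne : {c | c ∈ ψ.semigroup ∧ ∀ n : ℕ, c + n ∈ ψ.semigroup}.Nonempty :=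
    ⟨M, hM.mem_semigroup le_rfl, fun n => hM.mem_semigroup (Nat.le_add_right _ _)⟩
  have hc := (Nat.sInf_mem hne).2
  have key : ∀ n, ψ.ContainsOrder (ψ.conductor + n) → ψ.ContainsOrder ψ.conductor := by
    intro n
    induction n with
    | zero => exact id
    | succ n ih => exact fun h => ih (ContainsOrder.of_succ h (hc n))
  exact key M (hM.mono (by omega))

end Conductor

/-- `(x, y) ↦ (x, y - g)` is a coordinate change because `g` has weight above that of `y`. -/
theorem AEquiv.of_sub {ψ φ : PlaneParametrization K} {a b : ℕ}
    {g : MvPowerSeries (Fin 2) K} (hg : g ∈ MvPowerSeries.weightIdeal K ![a, b] (b + 1))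
    (hx : φ.x = ψ.x) (hy : φ.y = ψ.y - ψ.toAlgHom g) : ψ.AEquiv φ := by
  have hg0 : MvPowerSeries.constantCoeff g = 0 := by
    rw [← MvPowerSeries.coeff_zero_eq_constantCoeff_apply]
    exact hg 0 (by simp)
  have hs : MvPowerSeries.HasSubst ![(MvPowerSeries.X 0 : MvPowerSeries (Fin 2) K),
      MvPowerSeries.X 1 - g] := MvPowerSeries.hasSubst_of_constantCoeff_zero fun i => by
    fin_cases i <;> simp [hg0]
  have hw : ∀ s, ![(MvPowerSeries.X 0 : MvPowerSeries (Fin 2) K), MvPowerSeries.X 1 - g] s -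
      MvPowerSeries.X s ∈ MvPowerSeries.weightIdeal K ![a, b] (![a, b] s + 1) := by
    intro s
    fin_cases s
    · simp
    · simpa using hg
  refine AEquiv.of_generators (MvPowerSeries.substAlgEquiv hs hw) AlgEquiv.refl ?_ ?_
  · rw [MvPowerSeries.substAlgEquiv_apply, MvPowerSeries.subst_X hs]
    simpa [toAlgHom_X_zero] using hx
  · rw [MvPowerSeries.substAlgEquiv_apply, MvPowerSeries.subst_X hs]
    simpa [toAlgHom_X_one] using hy

end PlaneParametrization

/-! ### Reparametrization of the line and `a`-th roots. -/

namespace PowerSeries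

variable {K : Type*} [Field K]

theorem mem_weightIdeal_iff_X_pow_dvd {n : ℕ} {f : K⟦X⟧} :
    f ∈ MvPowerSeries.weightIdeal K (fun _ : Unit => 1) n ↔ X ^ n ∣ f := by
  have hw : ∀ d : Unit →₀ ℕ, Finsupp.weight (fun _ : Unit => 1) d = d () := fun d => by
    rw [Finsupp.weight_apply, Finsupp.sum_fintype _ _ (by simp)]
    simp
  rw [X_pow_dvd_iff, MvPowerSeries.mem_weightIdeal]
  constructor
  · intro h m hm
    exact h (Finsupp.single () m) (by rw [hw]; simpa using hm)
  · intro h d hd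
    rw [hw] at hd
    have := h _ hd
    rwa [coeff, ← Finsupp.unique_single d] at this

theorem hasSubst_const {τ : K⟦X⟧} (h : X ^ 2 ∣ τ - X) :
    MvPowerSeries.HasSubst (S := K) (fun _ : Unit => (τ : MvPowerSeries Unit K)) :=
  MvPowerSeries.hasSubst_of_constantCoeff_zero fun _ => by
    have h1 : X ∣ τ := by
      have := dvd_add ((dvd_pow_self X two_ne_zero).trans h) (dvd_refl X)
      rwa [sub_add_cancel] at this
    exact X_dvd_iff.mp h1

/-- Substitution of a series of the form `t + ⋯`, as an automorphism of `K⟦t⟧`. -/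
noncomputable def reparametrize (τ : K⟦X⟧) (h : X ^ 2 ∣ τ - X) : K⟦X⟧ ≃ₐ[K] K⟦X⟧ :=
  MvPowerSeries.substAlgEquiv (w := fun _ : Unit => 1) (hasSubst_const h)
    fun _ => mem_weightIdeal_iff_X_pow_dvd.mpr h

theorem reparametrize_X {τ : K⟦X⟧} (h : X ^ 2 ∣ τ - X) : reparametrize τ h X = τ :=
  (MvPowerSeries.substAlgEquiv_apply _ _ _).trans (MvPowerSeries.subst_X (hasSubst_const h) ())

theorem X_pow_dvd_reparametrize_sub {τ : K⟦X⟧} (h : X ^ 2 ∣ τ - X) {m n : ℕ}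
    (hm : X ^ (1 + m) ∣ τ - X) {f : K⟦X⟧} (hf : X ^ n ∣ f) :
    X ^ (n + m) ∣ reparametrize τ h f - f := by
  rw [← mem_weightIdeal_iff_X_pow_dvd]
  have e : reparametrize τ h f = MvPowerSeries.subst (fun _ : Unit => τ) f :=
    MvPowerSeries.substAlgEquiv_apply _ _ _
  rw [e]
  exact MvPowerSeries.subst_sub_mem_weightIdeal (w := fun _ : Unit => 1) (hasSubst_const h)
    (fun _ => mem_weightIdeal_iff_X_pow_dvd.mpr hm) (mem_weightIdeal_iff_X_pow_dvd.mpr hf)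

/-- Hensel's lemma gives the root near `1`. In `u^a - 1 = (∑ u^i)(u - 1)` the sum has constant term
`a ≠ 0`, so no order is lost. -/
theorem exists_pow_eq {a m : ℕ} (ha : (a : K) ≠ 0) (hm : 0 < m) {v : K⟦X⟧} (hv : X ^ m ∣ v - 1) :
    ∃ u, u ^ a = v ∧ X ^ m ∣ u - 1 := by
  have ha0 : a ≠ 0 := by rintro rfl; simp at ha
  have hX : (X : K⟦X⟧) ∣ v - 1 := (dvd_pow_self X hm.ne').trans hv
  have hH : HenselianRing K⟦X⟧ (Ideal.span {X}) := inferInstance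
  obtain ⟨u, hu, hu'⟩ := hH.is_henselian (Polynomial.X ^ a - Polynomial.C v)
    (Polynomial.monic_X_pow_sub_C v ha0) 1 (by
      rw [Ideal.mem_span_singleton]
      simpa using (dvd_neg.mpr hX)) (by
      have : IsUnit ((a : K⟦X⟧)) := by
        rw [← map_natCast (C (R := K))]
        exact (isUnit_iff_ne_zero.mpr ha).map _
      simpa [Polynomial.derivative_X_pow] using this.map (Ideal.Quotient.mk (Ideal.span {X})))
  have hu2 : u ^ a = v := by
    rw [Polynomial.IsRoot, Polynomial.eval_sub, Polynomial.eval_pow, Polynomial.eval_X,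
      Polynomial.eval_C, sub_eq_zero] at hu
    exact hu
  refine ⟨u, hu2, ?_⟩
  rw [Ideal.mem_span_singleton] at hu'
  have hc : constantCoeff u = 1 := by
    have := X_dvd_iff.mp hu'
    rwa [map_sub, map_one, sub_eq_zero] at this
  have hunit : IsUnit (∑ i ∈ Finset.range a, u ^ i) := by
    rw [isUnit_iff_constantCoeff, isUnit_iff_ne_zero]
    simpa [hc] using ha
  rw [← hu2, ← geom_sum_mul] at hv
  exact (hunit.dvd_mul_left).mp hv

theorem X_pow_dvd_X_mul_derivative {n : ℕ} {f : K⟦X⟧} (h : X ^ n ∣ f) :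
    X ^ n ∣ X * derivative K f := by
  rw [X_pow_dvd_iff] at h ⊢
  intro m hm
  rcases m with _ | m
  · simp
  · rw [coeff_succ_X_mul, coeff_derivative, h _ hm, zero_mul]

end PowerSeries

/-! ### Flows along vector fields attached to differentials. -/

/-- The operator `φ ↦ δ ∘ φ + φ ∘ D` on linear maps. -/
def intertwiner {K M N : Type*} [Field K] [AddCommGroup M] [Module K M] [AddCommGroup N]
    [Module K N] (δ : Module.End K N) (D : Module.End K M) (φ : M →ₗ[K] N) : M →ₗ[K] N :=
  δ ∘ₗ φ + φ ∘ₗ D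

/-- Composition with `δ` on the left and with `D` on the right commute, so the binomial formula
holds; formally, the exponential of the intertwiner is `φ ↦ e^δ ∘ φ ∘ e^D`. -/
theorem intertwiner_iterate_apply {K M N : Type*} [Field K] [AddCommGroup M] [Module K M]
    [AddCommGroup N] [Module K N] (δ : Module.End K N) (D : Module.End K M) (φ : M →ₗ[K] N)
    (n : ℕ) (f : M) : ((intertwiner δ D)^[n] φ) f =
      ∑ x ∈ Finset.HasAntidiagonal.antidiagonal n,
        n.choose x.1 • (δ ^ x.1) (φ ((D ^ x.2) f)) := by
  induction n generalizing f with
  | zero => simp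
  | succ n ih =>
    rw [Finset.sum_antidiagonal_choose_succ_nsmul (fun i j => (δ ^ i) (φ ((D ^ j) f))),
      Function.iterate_succ_apply', intertwiner, LinearMap.add_apply, LinearMap.comp_apply,
      LinearMap.comp_apply, ih, ih, map_sum, add_comm]
    congr 1
    refine Finset.sum_congr rfl fun x hx => ?_
    rw [Finset.HasAntidiagonal.mem_antidiagonal] at hx
    have hc : n.choose x.2 = n.choose x.1 := by
      rw [← hx, Nat.choose_symm_add]
    rw [hc, map_nsmul, pow_succ', Module.End.mul_apply]

namespace PlaneParametrization

variable {K : Type*} [Field K]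

open PowerSeries

/-- The image of a parametrization under a pair of automorphisms. -/
noncomputable def transform (ψ : PlaneParametrization K)
    (l : MvPowerSeries (Fin 2) K ≃ₐ[K] MvPowerSeries (Fin 2) K) (r : K⟦X⟧ ≃ₐ[K] K⟦X⟧)
    (hx : X ∣ ψ.toAlgHom (l (.X 0))) (hy : X ∣ ψ.toAlgHom (l (.X 1)))
    (h : ψ.toAlgHom (l (.X 0)) ≠ 0) : PlaneParametrization K where
  x := r (ψ.toAlgHom (l (.X 0)))
  y := r (ψ.toAlgHom (l (.X 1)))
  constantCoeff_x := X_dvd_iff.mp (by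
    simpa using X_pow_dvd_algEquiv r (n := 1) (by simpa using hx))
  constantCoeff_y := X_dvd_iff.mp (by
    simpa using X_pow_dvd_algEquiv r (n := 1) (by simpa using hy))
  ne_zero := Or.inl (by simpa using h)

theorem aequiv_transform (ψ : PlaneParametrization K)
    (l : MvPowerSeries (Fin 2) K ≃ₐ[K] MvPowerSeries (Fin 2) K) (r : K⟦X⟧ ≃ₐ[K] K⟦X⟧)
    (hx : X ∣ ψ.toAlgHom (l (.X 0))) (hy : X ∣ ψ.toAlgHom (l (.X 1)))
    (h : ψ.toAlgHom (l (.X 0)) ≠ 0) : ψ.AEquiv (ψ.transform l r hx hy h) :=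
  .of_generators l r rfl rfl

/-- Here `x = (tu)^a` with `u = 1 + O(t^(k - a))`, and `tu` becomes the new parameter. This alters
`y` only from order `b + k - a`, which exceeds `k` because `a < b`. -/
theorem exists_aequiv_x_eq {χ : PlaneParametrization K} {a b k : ℕ} (ha : (a : K) ≠ 0)
    (hab : a < b) (hbk : b < k) (hx : X ^ k ∣ χ.x - X ^ a) (hy : X ^ b ∣ χ.y) :
    ∃ φ, φ.x = X ^ a ∧ X ^ (k + 1) ∣ φ.y - χ.y ∧ χ.AEquiv φ := by
  obtain ⟨q, hq⟩ := hx
  have hk : (X : K⟦X⟧) ^ k = X ^ a * X ^ (k - a) := by rw [← pow_add]; congr 1; omega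
  have ha0 : a ≠ 0 := by rintro rfl; simp at ha
  obtain ⟨u, hu, hu1⟩ := exists_pow_eq (v := 1 + X ^ (k - a) * q) (m := k - a) ha (by omega)
    ⟨q, by ring⟩
  have hx : χ.x = (X * u) ^ a := by
    rw [mul_pow, hu, mul_add, mul_one, ← mul_assoc, ← hk, ← hq]
    ring
  have hτ : X ^ (1 + (k - a)) ∣ X * u - X := by
    obtain ⟨v, hv⟩ := hu1
    exact ⟨v, by rw [pow_add, pow_one, mul_assoc, ← hv]; ring⟩
  have hτ2 : X ^ 2 ∣ X * u - X := (pow_dvd_pow X (by omega)).trans hτ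
  set r := (reparametrize (X * u) hτ2).symm with hr
  have hrx : r χ.x = X ^ a := by
    rw [hr, AlgEquiv.symm_apply_eq, map_pow, reparametrize_X, hx]
  have hx0 : χ.x ≠ 0 := fun h0 => by
    rw [h0, map_zero] at hrx
    exact pow_ne_zero a (X_ne_zero (R := K)) hrx.symm
  refine ⟨χ.transform AlgEquiv.refl r (by simpa [toAlgHom_X_zero] using χ.X_dvd_x)
    (by simpa [toAlgHom_X_one] using χ.X_dvd_y) (by simpa [toAlgHom_X_zero] using hx0), ?_, ?_,
    χ.aequiv_transform _ _ _ _ _⟩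
  · simpa [transform, toAlgHom_X_zero] using hrx
  · have h1 := X_pow_dvd_reparametrize_sub hτ2 hτ (X_pow_dvd_algEquiv r hy)
    rw [hr, AlgEquiv.apply_symm_apply, ← hr, ← dvd_neg, neg_sub] at h1
    have h2 := (pow_dvd_pow X (show k + 1 ≤ b + (k - a) by omega)).trans h1
    simpa [transform, toAlgHom_X_one] using h2

section Flow

variable {ψ : PlaneParametrization K} {a b : ℕ}

theorem raisesFiltration_vectorField {A B : MvPowerSeries (Fin 2) K}
    (hA : A ∈ MvPowerSeries.weightIdeal K ![a, b] (b + 1))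
    (hB : B ∈ MvPowerSeries.weightIdeal K ![a, b] (a + 1)) :
    RaisesFiltration (MvPowerSeries.weightIdeal K ![a, b])
      (A • MvPowerSeries.pderiv K 1 - B • MvPowerSeries.pderiv K 0) where
  antitone := MvPowerSeries.weightIdeal_antitone _
  mem_zero := MvPowerSeries.mem_weightIdeal_zero _
  mul_mem := MvPowerSeries.mul_mem_weightIdeal
  map_mem {n f} hf := by
    refine Ideal.sub_mem _ ?_ ?_
    · exact MvPowerSeries.weightIdeal_antitone _ (by simp; omega)
        (MvPowerSeries.mul_mem_weightIdeal hA (MvPowerSeries.pderiv_mem_weightIdeal hf 1))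
    · exact MvPowerSeries.weightIdeal_antitone _ (by simp; omega)
        (MvPowerSeries.mul_mem_weightIdeal hB (MvPowerSeries.pderiv_mem_weightIdeal hf 0))

theorem raisesFiltration_smul_derivative {s : K⟦X⟧} (hs : X ^ 2 ∣ s) :
    RaisesFiltration (fun n => Ideal.span {(X : K⟦X⟧) ^ n}) (s • derivative K) where
  antitone m n h := by
    rw [Ideal.span_singleton_le_span_singleton]
    exact pow_dvd_pow X h
  mem_zero f := by simp
  mul_mem hf hg := by
    rw [Ideal.mem_span_singleton] at *
    rw [pow_add]
    exact mul_dvd_mul hf hg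
  map_mem {n f} hf := by
    rw [Ideal.mem_span_singleton] at *
    obtain ⟨q, rfl⟩ := hs
    have e : ((X ^ 2 * q) • derivative K) f = X * (X * derivative K f) * q := by
      simp only [Derivation.smul_apply, smul_eq_mul]; ring
    rw [e, pow_succ']
    exact Dvd.dvd.mul_right (mul_dvd_mul_left X (X_pow_dvd_X_mul_derivative hf)) _

/-- The equivalence is the approximate time-one flow of `D = A ∂_y - B ∂_x` and `δ = s d/dt`, where
`s x' = B(x(t), y(t))`. Its first-order term sends `f` to `∂_y f * h`, hence is `0` on `x` and `h`
on `y`. The automorphisms are substitutions prescribed by the truncated exponentials on the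
variables, because those exponentials are themselves only multiplicative up to order `p`. -/
theorem exists_aequiv_of_differential {p : ℕ} [Fact p.Prime] [CharP K p] {k : ℕ} (ha : 0 < a)
    (hab : a < b) (hbk : b < k) (hkp : k < p) (hx : ψ.x = X ^ a) (hy : X ^ b ∣ ψ.y)
    {A B : MvPowerSeries (Fin 2) K} (hA : A ∈ MvPowerSeries.weightIdeal K ![a, b] (b + 1))
    (hB : B ∈ MvPowerSeries.weightIdeal K ![a, b] (a + 1)) {h : K⟦X⟧} (hh : X ^ k ∣ h)
    (hω : ψ.toAlgHom A * derivative K ψ.x + ψ.toAlgHom B * derivative K ψ.y =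
      h * derivative K ψ.x) :
    ∃ φ, X ^ k ∣ φ.x - X ^ a ∧ X ^ (k + 1) ∣ φ.y - (ψ.y + h) ∧ ψ.AEquiv φ := by
  have haK : (a : K) ≠ 0 := by
    rw [Ne, CharP.cast_eq_zero_iff K p]
    exact Nat.not_dvd_of_pos_of_lt ha (by omega)
  have hx' : derivative K ψ.x = C (a : K) * X ^ (a - 1) := by
    rw [hx, Derivation.leibniz_pow, derivative_X]
    simp
  have hx'0 : derivative K ψ.x ≠ 0 := by
    rw [hx']
    exact mul_ne_zero ((map_ne_zero C).mpr haK) (pow_ne_zero _ X_ne_zero)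
  obtain ⟨q, hq⟩ := X_pow_dvd_toAlgHom (hx ▸ dvd_rfl) hy hB
  -- The quotient of `B` along the branch by `x'`; the orders `a + 1` and `a - 1` leave the factor
  -- `t^2` that lets `δ` raise the filtration.
  set s : K⟦X⟧ := X ^ 2 * (C (a : K)⁻¹ * q) with hs
  have hsx : s * derivative K ψ.x = ψ.toAlgHom B := by
    have e1 : (X : K⟦X⟧) ^ (a + 1) = X ^ 2 * X ^ (a - 1) := by rw [← pow_add]; congr 1; omega
    have e2 : C (a : K)⁻¹ * C (a : K) = 1 := by rw [← map_mul, inv_mul_cancel₀ haK, map_one]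
    rw [hx', hq, hs, e1]
    linear_combination (X ^ 2 * X ^ (a - 1) * q) * e2
  set D : Derivation K (MvPowerSeries (Fin 2) K) (MvPowerSeries (Fin 2) K) :=
    A • MvPowerSeries.pderiv K 1 - B • MvPowerSeries.pderiv K 0 with hD
  set δ : Derivation K K⟦X⟧ K⟦X⟧ := s • derivative K with hδ
  have hRD : RaisesFiltration (MvPowerSeries.weightIdeal K ![a, b]) D :=
    raisesFiltration_vectorField hA hB
  have hRδ : RaisesFiltration (fun n => Ideal.span {(X : K⟦X⟧) ^ n}) δ :=
    raisesFiltration_smul_derivative (dvd_mul_right _ _)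
  have hp0 : 0 < p := by omega
  have hdvd : ∀ {n : ℕ} {f : MvPowerSeries (Fin 2) K},
      f ∈ MvPowerSeries.weightIdeal K ![a, b] n → X ^ n ∣ ψ.toAlgHom f :=
    fun hf => X_pow_dvd_toAlgHom (hx ▸ dvd_rfl) hy hf
  have hXw : ∀ i, (MvPowerSeries.X i : MvPowerSeries (Fin 2) K) ∈
      MvPowerSeries.weightIdeal K ![a, b] (![a, b] i) := MvPowerSeries.X_mem_weightIdeal _
  have hXw1 : ∀ i, (MvPowerSeries.X i : MvPowerSeries (Fin 2) K) ∈
      MvPowerSeries.weightIdeal K ![a, b] 1 := fun i =>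
    MvPowerSeries.weightIdeal_antitone _ (by fin_cases i <;> simp <;> omega) (hXw i)
  -- the automorphism of `K⟦x, y⟧`
  have hlw : ∀ i, truncExp p (D : Module.End K _) (MvPowerSeries.X i) - MvPowerSeries.X i ∈
      MvPowerSeries.weightIdeal K ![a, b] (![a, b] i + 1) := fun i =>
    hRD.truncExp_sub_mem hp0 (hXw i)
  have hls : MvPowerSeries.HasSubst fun i : Fin 2 =>
      truncExp p (D : Module.End K _) (MvPowerSeries.X i : MvPowerSeries (Fin 2) K) :=
    MvPowerSeries.hasSubst_of_constantCoeff_zero fun i => by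
      rw [← MvPowerSeries.coeff_zero_eq_constantCoeff_apply]
      exact hRD.truncExp_mem (hXw1 i) 0 (by simp)
  set l := MvPowerSeries.substAlgEquiv hls hlw with hl
  have hlX : ∀ i, l (MvPowerSeries.X i) = truncExp p (D : Module.End K _) (MvPowerSeries.X i) :=
    fun i => (MvPowerSeries.substAlgEquiv_apply hls hlw _).trans (MvPowerSeries.subst_X hls i)
  have hlE : ∀ f, l f - truncExp p (D : Module.End K _) f ∈
      MvPowerSeries.weightIdeal K ![a, b] p := fun f =>
    hRD.algHom_sub_truncExp_mem (fun i : Fin 2 => MvPowerSeries.X i) hXw1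
      (fun f => MvPowerSeries.exists_eq_C_add_X_mul f)
      (l : MvPowerSeries (Fin 2) K →ₐ[K] MvPowerSeries (Fin 2) K) hlX f
  -- the automorphism of `K⟦t⟧`
  have hτ : X ^ 2 ∣ truncExp p (δ : Module.End K K⟦X⟧) X - X := by
    rw [← Ideal.mem_span_singleton]
    exact hRδ.truncExp_sub_mem hp0 (n := 1) (by simp)
  set r := reparametrize _ hτ with hr
  have hrE : ∀ f, X ^ p ∣ r f - truncExp p (δ : Module.End K K⟦X⟧) f := fun f => by
    rw [← Ideal.mem_span_singleton]
    refine hRδ.algHom_sub_truncExp_mem (fun _ : Unit => X)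
      (fun _ => by simp) (fun f => ?_) (r : K⟦X⟧ →ₐ[K] K⟦X⟧)
      (fun _ => reparametrize_X hτ) f
    obtain ⟨c, g, hg⟩ := exists_eq_C_add_X_mul f
    exact ⟨c, fun _ => g, by simpa using hg⟩
  -- comparison with the exponential of the intertwining operator
  set Ψ : MvPowerSeries (Fin 2) K →ₗ[K] K⟦X⟧ := ψ.toAlgHom.toLinearMap with hΨ
  set T : ℕ → MvPowerSeries (Fin 2) K →ₗ[K] K⟦X⟧ := fun n =>
    (intertwiner (δ : Module.End K K⟦X⟧) (D : Module.End K _))^[n] Ψ with hT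
  have hTs : ∀ n f, T (n + 1) f = δ (T n f) + T n (D f) := fun n f => by
    simp only [hT, Function.iterate_succ_apply']
    rfl
  have hcmp : ∀ f, X ^ p ∣ r (ψ.toAlgHom (l f)) -
      ∑ n ∈ Finset.range p, (n.factorial : K)⁻¹ • T n f := by
    intro f
    have h1 := hrE (ψ.toAlgHom (l f))
    have h2 : X ^ p ∣ truncExp p (δ : Module.End K K⟦X⟧) (ψ.toAlgHom (l f)) -
        truncExp p (δ : Module.End K K⟦X⟧)
          (ψ.toAlgHom (truncExp p (D : Module.End K _) f)) := by
      rw [← map_sub, ← map_sub, ← Ideal.mem_span_singleton]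
      exact hRδ.truncExp_mem (Ideal.mem_span_singleton.mpr (hdvd (hlE f)))
    have h3 := Finset.sum_range_sum_range_sub_mem
      ((Ideal.span {(X : K⟦X⟧) ^ p}).restrictScalars K) p
      (fun i j => ((i.factorial : K)⁻¹ * (j.factorial : K)⁻¹) •
        ((δ : Module.End K K⟦X⟧) ^ i) (Ψ (((D : Module.End K _) ^ j) f)))
      (fun i j hij => by
        refine Submodule.smul_mem _ _ ?_
        have h4 : Ψ (((D : Module.End K _) ^ j) f) ∈ Ideal.span {(X : K⟦X⟧) ^ j} :=
          Ideal.mem_span_singleton.mpr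
            (hdvd (by simpa using hRD.pow_mem (hRD.mem_zero f) j))
        exact hRδ.antitone (by omega) (hRδ.pow_mem h4 i))
    rw [Submodule.restrictScalars_mem, Ideal.mem_span_singleton] at h3
    have e1 : truncExp p (δ : Module.End K K⟦X⟧)
          (ψ.toAlgHom (truncExp p (D : Module.End K _) f)) =
        ∑ i ∈ Finset.range p, ∑ j ∈ Finset.range p,
          ((i.factorial : K)⁻¹ * (j.factorial : K)⁻¹) •
          ((δ : Module.End K K⟦X⟧) ^ i) (Ψ (((D : Module.End K _) ^ j) f)) := by
      rw [truncExp_apply]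
      refine Finset.sum_congr rfl fun i _ => ?_
      rw [truncExp_apply, map_sum, map_sum, Finset.smul_sum]
      refine Finset.sum_congr rfl fun j _ => ?_
      rw [map_smul, map_smul, smul_smul]
      rfl
    have e2 : ∑ n ∈ Finset.range p, (n.factorial : K)⁻¹ • T n f =
        ∑ n ∈ Finset.range p, ∑ x ∈ Finset.HasAntidiagonal.antidiagonal n,
          ((x.1.factorial : K)⁻¹ * (x.2.factorial : K)⁻¹) •
          ((δ : Module.End K K⟦X⟧) ^ x.1) (Ψ (((D : Module.End K _) ^ x.2) f)) := by
      refine Finset.sum_congr rfl fun n hn => ?_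
      simp only [hT]
      rw [intertwiner_iterate_apply, Finset.smul_sum]
      refine Finset.sum_congr rfl fun x hx => ?_
      rw [← inv_factorial_mul_choose (K := K) (Finset.mem_range.mp hn) hx, mul_smul,
        Nat.cast_smul_eq_nsmul]
    rw [← e1, ← e2] at h3
    have := dvd_add (dvd_add h1 h2) h3
    convert this using 1
    ring
  -- the terms of the exponential
  have hT1 : ∀ f, T 1 f = ψ.toAlgHom (MvPowerSeries.pderiv K 1 f) * h := by
    intro f
    have e1 : T 1 f = s * derivative K (ψ.toAlgHom f) +
        ψ.toAlgHom (A * MvPowerSeries.pderiv K 1 f - B * MvPowerSeries.pderiv K 0 f) := hTs 0 f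
    -- After multiplication by `x'` the `∂_x f` terms cancel by the choice of `s`, and `∂_y f` is
    -- left multiplied by the given form, which equals `h x'`.
    refine mul_right_cancel₀ hx'0 ?_
    rw [e1, derivative_toAlgHom, map_sub, map_mul, map_mul]
    linear_combination (ψ.toAlgHom (MvPowerSeries.pderiv K 1 f)) * hω +
      (ψ.toAlgHom (MvPowerSeries.pderiv K 0 f) * derivative K ψ.x +
        ψ.toAlgHom (MvPowerSeries.pderiv K 1 f) * derivative K ψ.y) * hsx
  -- If `f` has weight above `b`, then `∂_y f` has positive weight, so the first-order term gains
  -- one more order; `δ` and `D` preserve this gain.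
  have hTk : ∀ n, (∀ f, X ^ k ∣ T (n + 1) f) ∧
      ∀ f ∈ MvPowerSeries.weightIdeal K ![a, b] (b + 1), X ^ (k + 1) ∣ T (n + 1) f := by
    intro n
    induction n with
    | zero =>
      refine ⟨fun f => ?_, fun f hf => ?_⟩
      · rw [hT1]
        exact Dvd.dvd.mul_left hh _
      · rw [hT1, pow_succ']
        refine mul_dvd_mul ?_ hh
        have := hdvd (MvPowerSeries.pderiv_mem_weightIdeal hf 1)
        simpa using this
    | succ n ih =>
      have hδk : ∀ {m : ℕ} {g : K⟦X⟧}, X ^ m ∣ g → X ^ (m + 1) ∣ δ g := fun hg =>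
        Ideal.mem_span_singleton.mp (hRδ.map_mem (Ideal.mem_span_singleton.mpr hg))
      refine ⟨fun f => ?_, fun f hf => ?_⟩
      · rw [hTs]
        exact dvd_add ((pow_dvd_pow X (Nat.le_succ k)).trans (hδk (ih.1 f))) (ih.1 _)
      · rw [hTs]
        exact dvd_add (hδk (ih.1 f))
          (ih.2 _ (MvPowerSeries.weightIdeal_antitone _ (Nat.le_succ _) (hRD.map_mem hf)))
  -- Since `D y = A` has weight above `b`, second and higher terms do not affect the coefficient of
  -- `t^k` in `y`.
  have hTy : ∀ n, X ^ (k + 1) ∣ T (n + 2) (MvPowerSeries.X 1) := by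
    intro n
    have hDy : D (MvPowerSeries.X 1) = A := by
      simp [hD]
    rw [hTs, hDy]
    exact dvd_add (Ideal.mem_span_singleton.mp
      (hRδ.map_mem (Ideal.mem_span_singleton.mpr ((hTk n).1 _)))) ((hTk n).2 _ hA)
  have hfx : X ^ k ∣ r (ψ.toAlgHom (l (.X 0))) - X ^ a := by
    have h1 := (pow_dvd_pow X hkp.le).trans (hcmp (.X 0))
    obtain ⟨q, rfl⟩ : ∃ q, p = q + 1 := ⟨p - 1, by omega⟩
    rw [Finset.sum_range_succ'] at h1
    have h2 : X ^ k ∣ ∑ n ∈ Finset.range q, ((n + 1).factorial : K)⁻¹ • T (n + 1) (.X 0) :=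
      Finset.dvd_sum fun n _ => by
        rw [smul_eq_C_mul]
        exact Dvd.dvd.mul_left ((hTk n).1 _) _
    have h3 : T 0 (.X 0) = X ^ a := by
      rw [← hx, ← toAlgHom_X_zero]; rfl
    rw [h3] at h1
    have := dvd_add h1 h2
    convert this using 1
    simp only [Nat.factorial_zero, Nat.cast_one, inv_one, one_smul]
    ring
  have hfy : X ^ (k + 1) ∣ r (ψ.toAlgHom (l (.X 1))) - (ψ.y + h) := by
    have h1 := (pow_dvd_pow X (show k + 1 ≤ p from hkp)).trans (hcmp (.X 1))
    obtain ⟨q, rfl⟩ : ∃ q, p = q + 2 := ⟨p - 2, by omega⟩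
    rw [Finset.sum_range_succ', Finset.sum_range_succ'] at h1
    have h2 : X ^ (k + 1) ∣ ∑ n ∈ Finset.range q,
        ((n + 1 + 1).factorial : K)⁻¹ • T (n + 1 + 1) (.X 1) :=
      Finset.dvd_sum fun n _ => by
        rw [smul_eq_C_mul]
        exact Dvd.dvd.mul_left (hTy n) _
    have h3 : T 0 (.X 1) = ψ.y := by
      rw [← toAlgHom_X_one]; rfl
    have h4 : T (0 + 1) (.X 1) = h := by
      rw [zero_add, hT1, MvPowerSeries.pderiv_X]
      simp
    rw [h3, h4] at h1
    have := dvd_add h1 h2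
    convert this using 1
    simp only [Nat.factorial_zero, zero_add, Nat.factorial_one, Nat.cast_one, inv_one, one_smul]
    ring
  have hlx0 : ψ.toAlgHom (l (.X 0)) ≠ 0 := by
    intro h0
    rw [h0, map_zero, zero_sub, dvd_neg, X_pow_dvd_iff] at hfx
    simpa using hfx a (by omega)
  have hl1 : ∀ i, X ∣ ψ.toAlgHom (l (.X i)) := fun i => by
    rw [hlX, ← pow_one X]
    exact hdvd (hRD.truncExp_mem (hXw1 i))
  exact ⟨ψ.transform l r (hl1 0) (hl1 1) hlx0, hfx, hfy, ψ.aequiv_transform _ _ _ _ _⟩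

end Flow

end PlaneParametrization

/-! ### Values of functions and differentials in terms of low-order coefficients. -/

namespace MvPowerSeries

variable {σ R : Type*} [CommRing R]

theorem pow_mem_weightIdeal {w : σ → ℕ} {n : ℕ} {f : MvPowerSeries σ R}
    (hf : f ∈ weightIdeal R w n) (i : ℕ) : f ^ i ∈ weightIdeal R w (n * i) := by
  induction i with
  | zero => exact mem_weightIdeal_zero w _
  | succ i ih =>
    rw [pow_succ, Nat.mul_succ]
    exact mul_mem_weightIdeal ih hf

end MvPowerSeries

namespace PlaneParametrization

variable {K : Type*} [Field K]

open PowerSeries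

/-- `t` times the differential `A dx + B dy` pulled back to the branch (and divided by `dt`). -/
noncomputable def logForm (ψ : PlaneParametrization K) (A B : MvPowerSeries (Fin 2) K) : K⟦X⟧ :=
  X * (ψ.toAlgHom A * derivative K ψ.x + ψ.toAlgHom B * derivative K ψ.y)

theorem exists_of_mem_semimodule {ψ : PlaneParametrization K} {s : ℕ} (hs : s ∈ ψ.semimodule)
    (hs0 : s ≠ 0) : ∃ A B, (∀ m < s, coeff m (ψ.logForm A B) = 0) ∧
      coeff s (ψ.logForm A B) ≠ 0 := by
  rcases hs with ⟨w, hw, n, hn, rfl⟩ | hs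
  · obtain ⟨A, B, rfl⟩ := mem_differentials.mp hw
    rw [order_eq_nat] at hn
    refine ⟨A, B, fun m hm => ?_, ?_⟩
    · rcases m with _ | m
      · simp [logForm]
      · rw [logForm, coeff_succ_X_mul]
        exact hn.2 m (by omega)
    · rw [logForm, coeff_succ_X_mul]
      exact hn.1
  · exact absurd hs hs0

theorem mem_semimodule_of_coeff {ψ : PlaneParametrization K} {s : ℕ}
    {A B : MvPowerSeries (Fin 2) K} (h : ∀ m < s, coeff m (ψ.logForm A B) = 0)
    (hs : coeff s (ψ.logForm A B) ≠ 0) : s ∈ ψ.semimodule := by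
  rcases s with _ | n
  · exact Or.inr rfl
  · refine Or.inl ⟨_, mem_differentials.mpr ⟨A, B, rfl⟩, n, order_eq_nat.mpr ⟨?_, fun i hi => ?_⟩,
      rfl⟩
    · rwa [logForm, coeff_succ_X_mul] at hs
    · have := h (i + 1) (by omega)
      rwa [logForm, coeff_succ_X_mul] at this

/-- Separating the exponents `0`, `1` and at least `2` turns all comparisons of weights into linear
ones. -/
theorem mul_trichotomy (a i : ℕ) :
    (i = 0 ∧ a * i = 0) ∨ (i = 1 ∧ a * i = a) ∨ (2 ≤ i ∧ 2 * a ≤ a * i) := by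
  rcases i with _ | _ | i
  · simp
  · simp
  · right; right
    exact ⟨by omega, by rw [mul_comm]; exact Nat.mul_le_mul_left a (by omega)⟩

namespace IsClose

variable {ψ : PlaneParametrization K} {a b k : ℕ}

theorem logForm_eq (h : ψ.IsClose a b k) (A B : MvPowerSeries (Fin 2) K) :
    ψ.logForm A B = C (a : K) * (ψ.toAlgHom A * ψ.x) +
      ψ.toAlgHom B * (X * derivative K ψ.y) := by
  have h1 : X * derivative K ψ.x = C (a : K) * ψ.x := by
    rw [h.x_eq, Derivation.leibniz_pow, derivative_X]
    have : (X : K⟦X⟧) ^ a = X * X ^ (a - 1) := by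
      rw [← pow_succ']; congr 1; have := h.pos; omega
    rw [this]
    simp
    ring
  rw [logForm]
  linear_combination ψ.toAlgHom A * h1

theorem coeff_logForm (h : ψ.IsClose a b k) (A B : MvPowerSeries (Fin 2) K) (n : ℕ) :
    coeff n (ψ.logForm A B) = a * coeff n (ψ.toAlgHom A * ψ.x) +
      coeff n (ψ.toAlgHom B * (X * derivative K ψ.y)) := by
  rw [h.logForm_eq, map_add, coeff_C_mul]

theorem mono (h : ψ.IsClose a b k) {m : ℕ} (hb : b < m) (hm : m ≤ k) : ψ.IsClose a b m :=
  ⟨h.pos, h.lt_right, hb, h.x_eq, (pow_dvd_pow X hm).trans h.y_sub⟩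

theorem coeff_y (h : ψ.IsClose a b k) {n : ℕ} (hn : n < k) :
    coeff n ψ.y = if n = b then 1 else 0 := by
  have := X_pow_dvd_iff.mp h.y_sub n hn
  rwa [map_sub, coeff_X_pow, sub_eq_zero] at this

theorem succ_of_coeff_eq_zero (h : ψ.IsClose a b k) (h0 : coeff k ψ.y = 0) :
    ψ.IsClose a b (k + 1) := by
  refine ⟨h.pos, h.lt_right, h.lt_bound.trans (Nat.lt_succ_self k), h.x_eq, ?_⟩
  rw [X_pow_dvd_iff]
  intro m hm
  rcases Nat.lt_succ_iff_lt_or_eq.mp hm with hm | rfl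
  · exact X_pow_dvd_iff.mp h.y_sub m hm
  · rw [map_sub, h0, coeff_X_pow, if_neg (by have := h.lt_bound; omega), sub_zero]

theorem mono_mul_x (i j : ℕ) : ψ.x ^ i * ψ.y ^ j * ψ.x = ψ.x ^ (i + 1) * ψ.y ^ j := by ring

theorem mem_semigroup (h : ψ.IsClose a b k) (i j : ℕ) : a * i + b * j ∈ ψ.semigroup := by
  have hk := h.lt_bound
  refine ⟨ψ.x ^ i * ψ.y ^ j, ⟨.X 0 ^ i * .X 1 ^ j, ?_⟩, ?_⟩
  · change ψ.toAlgHom _ = _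
    rw [map_mul, map_pow, map_pow, toAlgHom_X_zero, toAlgHom_X_one]
  · rw [order_eq_nat]
    refine ⟨?_, fun m hm => ?_⟩
    · rw [h.coeff_mono (by omega), if_pos rfl]
      exact one_ne_zero
    · rw [h.coeff_mono (by omega), if_neg (by omega)]

theorem multiplicity_eq (h : ψ.IsClose a b k) : ψ.multiplicity = a := by
  have hab := h.lt_right
  have hk := h.lt_bound
  have ha : a ∈ {n | n ∈ ψ.semigroup ∧ n ≠ 0} :=
    ⟨by simpa using h.mem_semigroup 1 0, h.pos.ne'⟩
  refine le_antisymm (Nat.sInf_le ha) (le_csInf ⟨a, ha⟩ ?_)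
  rintro n ⟨⟨_, ⟨f, rfl⟩, hf⟩, hn⟩
  by_contra hlt
  rw [order_eq_nat] at hf
  refine hf.1 ?_
  change coeff n (ψ.toAlgHom f) = 0
  rw [← mul_one (ψ.toAlgHom f)]
  refine coeff_toAlgHom_mul_eq_zero _ _ _ _ fun d _ => ?_
  rw [mul_one]
  rcases mul_trichotomy a (d 0) with h1 | h1 | h1 <;>
    rcases mul_trichotomy b (d 1) with h2 | h2 | h2 <;>
    rw [h.coeff_mono (by omega), if_neg (by omega)]

theorem finsupp_ext {d d' : Fin 2 →₀ ℕ} (h0 : d 0 = d' 0) (h1 : d 1 = d' 1) : d = d' := by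
  ext i
  fin_cases i
  · exact h0
  · exact h1

/-- A value `k + a` of the semigroup is already a value of `⟨a, b⟩`. -/
theorem exists_eq_of_mem_semigroup (h : ψ.IsClose a b k) (hdvd : ¬ a ∣ b)
    (hk : k + a ∈ ψ.semigroup) : ∃ i j, k + a = a * i + b * j := by
  by_contra hnot
  push Not at hnot
  have hpos := h.pos
  have hab := h.lt_right
  have hbk := h.lt_bound
  obtain ⟨_, ⟨f, rfl⟩, hf⟩ := hk
  rw [order_eq_nat] at hf
  have hf1 : coeff (k + a) (ψ.toAlgHom f) ≠ 0 := hf.1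
  have hf2 : ∀ i < k + a, coeff i (ψ.toAlgHom f) = 0 := hf.2
  have hdvd' : ∀ i, a * i ≠ b := fun i hi => hdvd ⟨i, hi.symm⟩
  have hdvd2 : ∀ i, a * i ≠ a + b := fun i hi => hdvd ⟨i - 1, by
    rw [Nat.mul_sub, mul_one]; omega⟩
  -- Only `y` and `xy` have correction terms at order `k + a` or below. Their leading orders `b` and
  -- `a + b` lie below `k + a` and are attained by no other monomial that can occur, so both
  -- coefficients vanish; all remaining monomials contribute only exponents of `⟨a, b⟩`.
  have h01 : MvPowerSeries.coeff (Finsupp.single 1 1) f = 0 := by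
    have := coeff_toAlgHom_mul_eq_single ψ f 1 b (Finsupp.single 1 1) fun d hd _ => by
      rw [mul_one]
      have h0 := hdvd' (d 0)
      rcases mul_trichotomy b (d 1) with h2 | h2 | h2
      · rw [h.coeff_mono (by omega), if_neg (by omega)]
      · rw [h.coeff_mono (by omega), if_neg]
        intro h3
        have h4 : a * d 0 = 0 := by omega
        have h5 : d 0 = 0 := by
          rcases Nat.mul_eq_zero.mp h4 with h5 | h5 <;> omega
        exact hd (finsupp_ext (by simp [h5]) (by simp [h2.1]))
      · rw [h.coeff_mono (by omega), if_neg (by omega)]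
    rw [mul_one, hf2 b (by omega), mul_one, h.coeff_mono (by simp; omega)] at this
    simpa using this.symm
  have h11 : MvPowerSeries.coeff (Finsupp.single 0 1 + Finsupp.single 1 1) f = 0 := by
    have := coeff_toAlgHom_mul_eq_single ψ f 1 (a + b) (Finsupp.single 0 1 + Finsupp.single 1 1)
      fun d hd hd0 => by
        rw [mul_one]
        have h0 := hdvd2 (d 0)
        rcases mul_trichotomy b (d 1) with h2 | h2 | h2
        · rw [h.coeff_mono (by omega), if_neg (by omega)]
        · rcases mul_trichotomy a (d 0) with h3 | h3 | h3
          · exact absurd ((finsupp_ext (d := d) (d' := Finsupp.single 1 1)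
            (by simp [h3.1]) (by simp [h2.1])).symm ▸ h01) hd0
          · exact absurd (finsupp_ext (by simp [h3.1]) (by simp [h2.1])) hd
          · rw [h.coeff_mono (by omega), if_neg (by omega)]
        · rw [h.coeff_mono (by omega), if_neg (by omega)]
    rw [mul_one, hf2 (a + b) (by omega), mul_one, h.coeff_mono (by simp; omega)] at this
    simpa using this.symm
  refine hf1 ?_
  rw [← mul_one (ψ.toAlgHom f)]
  refine coeff_toAlgHom_mul_eq_zero _ _ _ _ fun d hd => ?_
  have hn := hnot (d 0) (d 1)
  rw [mul_one]
  rcases mul_trichotomy b (d 1) with h2 | h2 | h2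
  · rw [h.coeff_mono (by omega), if_neg hn]
  · rcases mul_trichotomy a (d 0) with h3 | h3 | h3
    · exact absurd ((finsupp_ext (d := d) (d' := Finsupp.single 1 1)
            (by simp [h3.1]) (by simp [h2.1])).symm ▸ h01) hd
    · exact absurd ((finsupp_ext (d := d) (d' := Finsupp.single 0 1 + Finsupp.single 1 1)
            (by simp [h3.1]) (by simp [h2.1])).symm ▸ h11) hd
    · rw [h.coeff_mono (by omega), if_neg hn]
  · rw [h.coeff_mono (by omega), if_neg hn]

section LogForm

variable {A B : MvPowerSeries (Fin 2) K}

/-- At order `b` only `dy` contributes, with factor `b`: a term `x^i dx` would need `a ∣ b`. -/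
theorem coeff_zero_eq_zero (h : ψ.IsClose a b k) (hdvd : ¬ a ∣ b) (hb : (b : K) ≠ 0)
    (h0 : coeff b (ψ.logForm A B) = 0) : MvPowerSeries.coeff 0 B = 0 := by
  have hpos := h.pos
  have hab := h.lt_right
  have hbk := h.lt_bound
  rw [h.coeff_logForm, coeff_toAlgHom_mul_eq_zero ψ A _ b, coeff_toAlgHom_mul_eq_single ψ B _ b 0,
    h.coeff_mono_mul_derivative (by simp; omega)] at h0
  · simpa [hb] using h0
  · intro d hd _
    rw [h.coeff_mono_mul_derivative (by omega), if_neg]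
    intro h1
    rw [mul_add, mul_one] at h1
    have h2 : a * d 0 = 0 := by omega
    have h3 : b * d 1 = 0 := by omega
    refine hd (finsupp_ext ?_ ?_)
    · rcases Nat.mul_eq_zero.mp h2 with h | h
      · omega
      · exact h
    · rcases Nat.mul_eq_zero.mp h3 with h | h
      · omega
      · exact h
  · intro d _
    rw [mono_mul_x]
    have h1 : a * (d 0 + 1) ≠ b := fun h => hdvd ⟨_, h.symm⟩
    rcases mul_trichotomy b (d 1) with h2 | h2 | h2 <;>
      rw [h.coeff_mono (by rw [mul_add]; omega), if_neg (by rw [mul_add] at h1 ⊢; omega)]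

theorem coeff_eq_zero_of_snd_eq_zero (h : ψ.IsClose a b k) (ha : (a : K) ≠ 0)
    (hB : MvPowerSeries.coeff 0 B = 0) (h0 : ∀ n < a + b, coeff n (ψ.logForm A B) = 0)
    {d₀ : Fin 2 →₀ ℕ} (hd1 : d₀ 1 = 0) (hd0 : a * d₀ 0 < b) : MvPowerSeries.coeff d₀ A = 0 := by
  have hpos := h.pos
  have hab := h.lt_right
  have hbk := h.lt_bound
  have h1 := h0 (a * (d₀ 0 + 1)) (by rw [mul_add]; omega)
  rw [h.coeff_logForm, coeff_toAlgHom_mul_eq_single ψ A _ _ d₀, mono_mul_x,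
    coeff_toAlgHom_mul_eq_zero ψ B, h.coeff_mono (Or.inl hd1)] at h1
  · simpa [ha, hd1] using h1
  · intro d hd
    rw [mul_add, mul_one]
    have hd' : d 0 = 0 → d 1 = 0 → False := fun h2 h3 =>
      hd (finsupp_ext (d' := 0) h2 h3 ▸ hB)
    rcases mul_trichotomy a (d 0) with h2 | h2 | h2 <;>
      rcases mul_trichotomy b (d 1) with h3 | h3 | h3 <;>
      first
        | exact (hd' h2.1 h3.1).elim
        | rw [h.coeff_mono_mul_derivative (by omega), if_neg (by rw [mul_add]; omega)]
  · intro d hd _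
    rw [mono_mul_x]
    rcases mul_trichotomy b (d 1) with h3 | h3 | h3
    · rw [h.coeff_mono (Or.inl h3.1), if_neg]
      intro h4
      rw [h3.2, add_zero] at h4
      have := Nat.eq_of_mul_eq_mul_left hpos h4
      exact hd (finsupp_ext (by omega) (by omega))
    all_goals rw [h.coeff_mono (by simp only [mul_add]; omega),
      if_neg (by simp only [mul_add]; omega)]

theorem coeff_logForm_add (h : ψ.IsClose a b k) (hdvd : ¬ a ∣ b)
    (hB : MvPowerSeries.coeff 0 B = 0) :
    coeff (a + b) (ψ.logForm A B) = a * MvPowerSeries.coeff (Finsupp.single 1 1) A +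
      b * MvPowerSeries.coeff (Finsupp.single 0 1) B := by
  have hpos := h.pos
  have hab := h.lt_right
  have hbk := h.lt_bound
  rw [h.coeff_logForm, coeff_toAlgHom_mul_eq_single ψ A _ _ (Finsupp.single 1 1), mono_mul_x,
    coeff_toAlgHom_mul_eq_single ψ B _ _ (Finsupp.single 0 1), h.coeff_mono (by simp; omega),
    h.coeff_mono_mul_derivative (by simp; omega)]
  · simp [mul_comm]
  · intro d hd hd0
    have hd' : d 0 = 0 → d 1 = 0 → False := fun h2 h3 =>
      hd0 (finsupp_ext (d' := 0) h2 h3 ▸ hB)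
    have hd'' : d 0 = 1 → d 1 = 0 → False := fun h2 h3 =>
      hd (finsupp_ext (by simp [h2]) (by simp [h3]))
    rcases mul_trichotomy a (d 0) with h2 | h2 | h2 <;>
      rcases mul_trichotomy b (d 1) with h3 | h3 | h3 <;>
      first
        | exact (hd' h2.1 h3.1).elim
        | exact (hd'' h2.1 h3.1).elim
        | rw [h.coeff_mono_mul_derivative (by omega), if_neg (by rw [mul_add]; omega)]
  · intro d hd _
    rw [mono_mul_x]
    have hd'' : d 0 = 0 → d 1 = 1 → False := fun h2 h3 =>
      hd (finsupp_ext (by simp [h2]) (by simp [h3]))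
    have h4 : a * d 0 ≠ b := fun h => hdvd ⟨_, h.symm⟩
    rcases mul_trichotomy a (d 0) with h2 | h2 | h2 <;>
      rcases mul_trichotomy b (d 1) with h3 | h3 | h3 <;>
      first
        | exact (hd'' h2.1 h3.1).elim
        | rw [h.coeff_mono (by rw [mul_add]; omega), if_neg (by rw [mul_add]; omega)]

theorem coeff_X_mul_derivative (f : K⟦X⟧) (n : ℕ) :
    coeff n (X * derivative K f) = n * coeff n f := by
  rcases n with _ | n
  · simp
  · rw [coeff_succ_X_mul, coeff_derivative]
    push_cast
    ring

/-- No leading term has exponent `k + a`, and, once `dy` is excluded by `B(0) = 0`, only the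
corrections of `y dx` and `x dy` reach that order. -/
theorem coeff_logForm_add_of_notMem (h : ψ.IsClose a b k)
    (hk : ∀ i j, k + a ≠ a * i + b * j) (hB : MvPowerSeries.coeff 0 B = 0) :
    coeff (k + a) (ψ.logForm A B) = coeff k ψ.y *
      (a * MvPowerSeries.coeff (Finsupp.single 1 1) A +
        k * MvPowerSeries.coeff (Finsupp.single 0 1) B) := by
  have hpos := h.pos
  have hab := h.lt_right
  have hbk := h.lt_bound
  rw [h.coeff_logForm, coeff_toAlgHom_mul_eq_single ψ A _ _ (Finsupp.single 1 1), mono_mul_x,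
    coeff_toAlgHom_mul_eq_single ψ B _ _ (Finsupp.single 0 1)]
  · have e1 : coeff (k + a) (ψ.x * ψ.y) = coeff k ψ.y := by
      rw [h.x_eq, coeff_X_pow_mul]
    have e2 : coeff (k + a) (ψ.x * (X * derivative K ψ.y)) = k * coeff k ψ.y := by
      rw [h.x_eq, coeff_X_pow_mul, coeff_X_mul_derivative]
    simp only [Finsupp.single_apply]
    simp only [Fin.isValue, one_ne_zero, if_false, zero_ne_one, if_true, zero_add, pow_one,
      pow_zero, mul_one, e1, e2]
    ring
  · intro d hd hd0
    have hd' : d 0 = 0 → d 1 = 0 → False := fun h2 h3 =>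
      hd0 (finsupp_ext (d' := 0) h2 h3 ▸ hB)
    have hd'' : d 0 = 1 → d 1 = 0 → False := fun h2 h3 =>
      hd (finsupp_ext (by simp [h2]) (by simp [h3]))
    have h4 := hk (d 0) (d 1 + 1)
    rcases mul_trichotomy a (d 0) with h2 | h2 | h2 <;>
      rcases mul_trichotomy b (d 1) with h3 | h3 | h3 <;>
      first
        | exact (hd' h2.1 h3.1).elim
        | exact (hd'' h2.1 h3.1).elim
        | rw [h.coeff_mono_mul_derivative (by omega), if_neg h4]
  · intro d hd _
    rw [mono_mul_x]
    have hd'' : d 0 = 0 → d 1 = 1 → False := fun h2 h3 =>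
      hd (finsupp_ext (by simp [h2]) (by simp [h3]))
    have h4 := hk (d 0 + 1) (d 1)
    rcases mul_trichotomy a (d 0) with h2 | h2 | h2 <;>
      rcases mul_trichotomy b (d 1) with h3 | h3 | h3 <;>
      first
        | exact (hd'' h2.1 h3.1).elim
        | rw [h.coeff_mono (by rw [mul_add]; omega), if_neg h4]

/-- Differentials of low order take only values of `⟨a, b⟩`. -/
theorem lt_of_coeff_ne_zero (h : ψ.IsClose a b k) (hdvd : ¬ a ∣ b) (hb : (b : K) ≠ 0) {s : ℕ}
    (hs : ∀ i j, s ≠ a * i + b * j) (h0 : ∀ m < s, coeff m (ψ.logForm A B) = 0)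
    (hs0 : coeff s (ψ.logForm A B) ≠ 0) : a + b < s := by
  have hpos := h.pos
  have hab := h.lt_right
  have hbk := h.lt_bound
  by_contra hlt
  -- For `s ≤ a + b` corrections could only come from `dy`, and its coefficient vanishes as soon as
  -- `s > b`.
  have hB : b < s → MvPowerSeries.coeff 0 B = 0 := fun hbs =>
    h.coeff_zero_eq_zero hdvd hb (h0 b hbs)
  refine hs0 ?_
  rw [h.coeff_logForm, coeff_toAlgHom_mul_eq_zero ψ A, coeff_toAlgHom_mul_eq_zero ψ B, mul_zero,
    add_zero]
  · intro d hd
    have hd' : b < s → d 0 = 0 → d 1 = 0 → False := fun h1 h2 h3 =>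
      hd (finsupp_ext (d' := 0) h2 h3 ▸ hB h1)
    have h4 := hs (d 0) (d 1 + 1)
    rw [h.coeff_mono_mul_derivative, if_neg h4]
    rcases Nat.lt_or_ge b s with h5 | h5
    · have hd' := hd' h5
      rcases mul_trichotomy a (d 0) with h2 | h2 | h2 <;>
      rcases mul_trichotomy b (d 1) with h3 | h3 | h3 <;>
      first
        | exact (hd' h2.1 h3.1).elim
        | omega
    · omega
  · intro d _
    have h4 := hs (d 0 + 1) (d 1)
    rw [mono_mul_x, h.coeff_mono, if_neg h4]
    rw [mul_add]
    rcases mul_trichotomy a (d 0) with h2 | h2 | h2 <;>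
      rcases mul_trichotomy b (d 1) with h3 | h3 | h3 <;> omega

/-- The delicate coefficients are `A_y` of `y` in `A` and `B_x` of `x` in `B`. Orders `a + b` and `k
+ a` give `a A_y + b B_x = 0` and `a A_y + k B_x = 0`, a system with determinant `a(k - b) ≠ 0`. The
other low-weight coefficients are read off directly. -/
theorem weight_of_coeff_eq_zero (h : ψ.IsClose a b k) (hdvd : ¬ a ∣ b) (ha : (a : K) ≠ 0)
    (hkb : (k : K) - b ≠ 0) (hb : (b : K) ≠ 0) (hk : ∀ i j, k + a ≠ a * i + b * j)
    (hy : coeff k ψ.y ≠ 0) (h0 : ∀ n ≤ k + a, coeff n (ψ.logForm A B) = 0) :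
    A ∈ MvPowerSeries.weightIdeal K ![a, b] (b + 1) ∧
      B ∈ MvPowerSeries.weightIdeal K ![a, b] (a + 1) := by
  have hpos := h.pos
  have hab := h.lt_right
  have hbk := h.lt_bound
  have hB0 : MvPowerSeries.coeff 0 B = 0 := h.coeff_zero_eq_zero hdvd hb (h0 b (by omega))
  have hA0 := fun d => h.coeff_eq_zero_of_snd_eq_zero ha hB0 (fun n hn => h0 n (by omega)) (d₀ := d)
  have h1 := h.coeff_logForm_add (A := A) hdvd hB0
  have h2 := h.coeff_logForm_add_of_notMem (A := A) hk hB0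
  rw [h0 _ (by omega), eq_comm] at h1
  rw [h0 _ le_rfl, eq_comm, mul_eq_zero, or_iff_right hy] at h2
  have h3 : MvPowerSeries.coeff (Finsupp.single 0 1) B = 0 := by
    have : ((k : K) - b) * MvPowerSeries.coeff (Finsupp.single 0 1) B = 0 := by
      linear_combination h2 - h1
    exact (mul_eq_zero.mp this).resolve_left hkb
  have h4 : MvPowerSeries.coeff (Finsupp.single 1 1) A = 0 := by
    rw [h3, mul_zero, add_zero] at h1
    exact (mul_eq_zero.mp h1).resolve_left ha
  constructor
  · intro d hd
    rw [weight_pair] at hd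
    have hne : a * d 0 ≠ b := fun h => hdvd ⟨_, h.symm⟩
    rcases mul_trichotomy b (d 1) with h5 | h5 | h5
    · exact hA0 d h5.1 (by omega)
    · have h6 : d 0 = 0 := by
        rcases mul_trichotomy a (d 0) with h6 | h6 | h6 <;> omega
      rwa [finsupp_ext (d := d) (d' := Finsupp.single 1 1) (by simp [h6]) (by simp [h5.1])]
    · omega
  · intro d hd
    rw [weight_pair] at hd
    rcases mul_trichotomy b (d 1) with h5 | h5 | h5
    · rcases mul_trichotomy a (d 0) with h6 | h6 | h6
      · rwa [finsupp_ext (d := d) (d' := 0) h6.1 h5.1]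
      · rwa [finsupp_ext (d := d) (d' := Finsupp.single 0 1) (by simp [h6.1]) (by simp [h5.1])]
      · omega
    · omega
    · omega

end LogForm

theorem exists_aequiv_add {p : ℕ} [Fact p.Prime] [CharP K p] (h : ψ.IsClose a b k) {n : ℕ}
    (hbn : b < n) (hnp : n < p) {A B : MvPowerSeries (Fin 2) K}
    (hA : A ∈ MvPowerSeries.weightIdeal K ![a, b] (b + 1))
    (hB : B ∈ MvPowerSeries.weightIdeal K ![a, b] (a + 1))
    (h0 : ∀ m < n + a, coeff m (ψ.logForm A B) = 0) (hn : coeff (n + a) (ψ.logForm A B) ≠ 0)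
    (ε : K) :
    ∃ φ, φ.x = X ^ a ∧ X ^ (n + 1) ∣ φ.y - (ψ.y + C ε * X ^ n) ∧ ψ.AEquiv φ := by
  have hpos := h.pos
  have hab := h.lt_right
  have haK : (a : K) ≠ 0 := by
    rw [Ne, CharP.cast_eq_zero_iff K p]
    exact Nat.not_dvd_of_pos_of_lt hpos (by omega)
  obtain ⟨g, hg⟩ := X_pow_dvd_iff.mpr h0
  have hg0 : constantCoeff g ≠ 0 := by
    rwa [hg, coeff_X_pow_mul', if_pos le_rfl, Nat.sub_self,
      coeff_zero_eq_constantCoeff_apply] at hn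
  -- The form is multiplied by `a c` rather than `c`, since `t x' = a t^a`; then `h = c t^n g` has
  -- leading term `ε t^n`.
  set c := ε / constantCoeff g with hc
  have hω : ψ.toAlgHom (MvPowerSeries.C (a * c) * A) * derivative K ψ.x +
      ψ.toAlgHom (MvPowerSeries.C (a * c) * B) * derivative K ψ.y =
      (C c * X ^ n * g) * derivative K ψ.x := by
    have hx : X * derivative K ψ.x = C (a : K) * X ^ a := by
      rw [h.x_eq, Derivation.leibniz_pow, derivative_X]
      have : (X : K⟦X⟧) ^ a = X * X ^ (a - 1) := by
        rw [← pow_succ']; congr 1; omega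
      rw [this]
      simp
      ring
    rw [logForm] at hg
    refine mul_left_cancel₀ (X_ne_zero (R := K)) ?_
    rw [map_mul ψ.toAlgHom _ A, map_mul ψ.toAlgHom _ B, toAlgHom_C, map_mul C]
    linear_combination (C (a : K) * C c) * hg - C c * X ^ n * g * hx
  obtain ⟨φ, hφx, hφy, hφ⟩ := exists_aequiv_of_differential (p := p) hpos hab hbn hnp h.x_eq
    h.X_pow_dvd_y (Ideal.mul_mem_left _ (MvPowerSeries.C (a * c)) hA)
    (Ideal.mul_mem_left _ (MvPowerSeries.C (a * c)) hB)
    (Dvd.dvd.mul_right (dvd_mul_left _ (C c)) g) hω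
  have hyb : X ^ b ∣ φ.y := by
    have h1 := (pow_dvd_pow X (show b ≤ n + 1 by omega)).trans hφy
    have h2 : X ^ b ∣ ψ.y + C c * X ^ n * g :=
      dvd_add h.X_pow_dvd_y (Dvd.dvd.mul_right (Dvd.dvd.mul_left (pow_dvd_pow X hbn.le) _) g)
    simpa using dvd_add h1 h2
  obtain ⟨χ, hχx, hχy, hχ⟩ := exists_aequiv_x_eq haK hab hbn hφx hyb
  refine ⟨χ, hχx, ?_, hφ.trans hχ⟩
  have h3 : X ^ (n + 1) ∣ C c * X ^ n * g - C ε * X ^ n := by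
    have h4 : X ∣ C c * g - C ε := by
      rw [X_dvd_iff]
      simp [hc, div_mul_cancel₀ _ hg0]
    have e : C c * X ^ n * g - C ε * X ^ n = X ^ n * (C c * g - C ε) := by ring
    rw [e, pow_succ]
    exact mul_dvd_mul_left _ h4
  have := dvd_add (dvd_add hχy hφy) h3
  convert this using 1
  ring

end IsClose

end PlaneParametrization

/-! ### Reduction to the normal form. -/

namespace PlaneParametrization

variable {K : Type*} [Field K]

open PowerSeries

/-- The parametrization `(t^a, y)`. -/
noncomputable def ofPow (a : ℕ) (ha : 0 < a) (y : K⟦X⟧) (hy : X ∣ y) : PlaneParametrization K where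
  x := X ^ a
  y := y
  constantCoeff_x := X_dvd_iff.mp (dvd_pow_self X ha.ne')
  constantCoeff_y := X_dvd_iff.mp hy
  ne_zero := Or.inl (pow_ne_zero a X_ne_zero)

theorem ContainsOrder.of_x_eq_X {ψ : PlaneParametrization K} (hx : ψ.x = X) {c : ℕ}
    (hc : ψ.ContainsOrder c) : ψ.ContainsOrder 0 := by
  induction c with
  | zero => exact hc
  | succ c ih =>
    refine ih (hc.of_succ ⟨ψ.x ^ c, ⟨.X 0 ^ c, ?_⟩, ?_⟩)
    · exact (map_pow ψ.toAlgHom _ _).trans (by rw [toAlgHom_X_zero])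
    · rw [hx, order_X_pow]

/-- A difference of order beyond the conductor is a function `g(x, y)` on the branch, and `g` can be
taken of weight above `b`, so that `y - g` is a legitimate new coordinate. -/
theorem IsClose.aequiv_of_dvd_sub {φ χ : PlaneParametrization K} {a b c m : ℕ}
    (h : φ.IsClose a b (b + 1)) (hdvd : a = 1 ∨ ¬ a ∣ b) (hc : φ.ContainsOrder c) (hcm : c ≤ m)
    (hbm : b < m) (hx : χ.x = X ^ a) (hy : X ^ m ∣ φ.y - χ.y) : φ.AEquiv χ := by
  obtain ⟨g, hgw, hg⟩ : ∃ g ∈ MvPowerSeries.weightIdeal K ![a, b] (b + 1),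
      φ.toAlgHom g = φ.y - χ.y := by
    rcases hdvd with rfl | hdvd
    -- For `a = 1` low-weight monomials may cancel, so `g` is chosen explicitly as a multiple of
    -- `x^(b + 1)`.
    · have hx1 : φ.x = X := by rw [h.x_eq, pow_one]
      obtain ⟨f, hf⟩ := (pow_dvd_pow X (show b + 1 ≤ m from hbm)).trans hy
      obtain ⟨g, hg⟩ := hc.of_x_eq_X hx1 f (by simp)
      have hg : φ.toAlgHom g = f := hg
      refine ⟨.X 0 ^ (b + 1) * g, Ideal.mul_mem_right _ _ ?_, ?_⟩
      · simpa using MvPowerSeries.pow_mem_weightIdeal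
          (MvPowerSeries.X_mem_weightIdeal (R := K) ![1, b] 0) (b + 1)
      · rw [map_mul, map_pow, toAlgHom_X_zero, hg, hf, hx1]
    · obtain ⟨g, hg⟩ := hc.mono hcm _ hy
      have hg : φ.toAlgHom g = φ.y - χ.y := hg
      refine ⟨g, h.mem_weightIdeal_of_dvd hdvd ?_, hg⟩
      rw [hg]
      exact (pow_dvd_pow X (show b + 1 ≤ m from hbm)).trans hy
  refine AEquiv.of_sub hgw (hx.trans h.x_eq.symm) ?_
  rw [hg]
  ring

theorem isClose_monomial {χ : PlaneParametrization K} {a b : ℕ} (ha : 0 < a) (hab : a < b)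
    (hx : χ.x = X ^ a) (hy : χ.y = X ^ b) {k : ℕ} (hk : b < k) : χ.IsClose a b k :=
  ⟨ha, hab, hk, hx, by rw [hy, sub_self]; exact dvd_zero _⟩

theorem semimodule_subset_semigroup_of_monomial {χ : PlaneParametrization K} {a b : ℕ} (ha : 0 < a)
    (hab : a < b) (hx : χ.x = X ^ a) (hy : χ.y = X ^ b) : χ.semimodule ⊆ χ.semigroup := by
  intro s hs
  by_contra hns
  -- Any closeness bound is available; this one makes every coefficient up to order `s` free of
  -- corrections, so only exponents in `⟨a, b⟩` occur.
  have h := isClose_monomial ha hab hx hy (k := b + s + 1) (by omega)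
  have hform : ∀ i j, s ≠ a * i + b * j := fun i j e => hns (e ▸ h.mem_semigroup i j)
  have hs0 : s ≠ 0 := by simpa using hform 0 0
  obtain ⟨A, B, -, hAB⟩ := exists_of_mem_semimodule hs hs0
  refine hAB ?_
  rw [h.coeff_logForm, coeff_toAlgHom_mul_eq_zero, coeff_toAlgHom_mul_eq_zero, mul_zero, add_zero]
  · intro d _
    rw [h.coeff_mono_mul_derivative (by omega), if_neg (hform _ _)]
  · intro d _
    rw [IsClose.mono_mul_x, h.coeff_mono (by omega), if_neg (hform _ _)]

theorem zariskiNumber_eq_top {ψ : PlaneParametrization K} (h : ψ.semimodule ⊆ ψ.semigroup) :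
    ψ.zariskiNumber = ⊤ := by
  rw [zariskiNumber, Set.sdiff_eq_empty.mpr h]
  simp

/-- The bound `a + b < s` makes the truncated subtraction of the multiplicity a genuine one and
yields `λ > b`. -/
theorem zariskiNumber_cases (ψ : PlaneParametrization K) {a b : ℕ} (hm : ψ.multiplicity = a)
    (h : ∀ s ∈ ψ.semimodule, s ∉ ψ.semigroup → a + b < s) :
    ψ.semimodule ⊆ ψ.semigroup ∨ ∃ L : ℕ, ψ.zariskiNumber = L ∧ b < L ∧ L + a ∈ ψ.semimodule ∧
      L + a ∉ ψ.semigroup ∧ ∀ s ∈ ψ.semimodule, s < L + a → s ∈ ψ.semigroup := by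
  by_cases hsub : ψ.semimodule ⊆ ψ.semigroup
  · exact Or.inl hsub
  · right
    have hne : (ψ.semimodule \ ψ.semigroup).Nonempty := Set.sdiff_nonempty.mpr hsub
    have hmem := Nat.sInf_mem hne
    set s₀ := sInf (ψ.semimodule \ ψ.semigroup) with hs₀
    have hlt := h s₀ hmem.1 hmem.2
    have hL : s₀ - a + a = s₀ := by omega
    refine ⟨s₀ - a, ?_, by omega, hL.symm ▸ hmem.1, hL.symm ▸ hmem.2, fun s hs hsL => ?_⟩
    · have : (⨅ s ∈ ψ.semimodule \ ψ.semigroup, (s : ℕ∞)) = s₀ := by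
        refine le_antisymm (iInf₂_le s₀ hmem) (le_iInf₂ fun s hs => ?_)
        exact_mod_cast Nat.sInf_le hs
      rw [zariskiNumber, this, hm]
      norm_cast
    · by_contra hns
      have := Nat.sInf_le (show s ∈ ψ.semimodule \ ψ.semigroup from ⟨hs, hns⟩)
      omega

theorem cast_ne_zero_of_lt {p : ℕ} [CharP K p] {n : ℕ} (h0 : 0 < n) (hn : n < p) :
    (n : K) ≠ 0 := by
  rw [Ne, CharP.cast_eq_zero_iff K p]
  exact Nat.not_dvd_of_pos_of_lt h0 hn

theorem cast_sub_cast_ne_zero {p : ℕ} [CharP K p] {m n : ℕ} (h0 : m < n) (hn : n < p) :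
    (n : K) - m ≠ 0 := by
  rw [← Nat.cast_sub h0.le]
  exact cast_ne_zero_of_lt (p := p) (by omega) (by omega)

namespace IsClose

variable {φ : PlaneParametrization K} {a b k : ℕ}

/-- The form `a x dy - b y dx` cancels the contribution of `t^b` and turns the next term into `a(k -
b) y_k t^(k + a)`, nonzero because `k < p`. -/
theorem add_mem_semimodule {p : ℕ} [CharP K p] (h : φ.IsClose a b k) (hkp : k < p)
    (hy : coeff k φ.y ≠ 0) : k + a ∈ φ.semimodule := by
  have hpos := h.pos
  have hab := h.lt_right
  have hbk := h.lt_bound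
  have haK : (a : K) ≠ 0 := cast_ne_zero_of_lt (p := p) hpos (by omega)
  have e : φ.logForm (-(MvPowerSeries.C (b : K) * .X 1)) (MvPowerSeries.C (a : K) * .X 0) =
      X ^ a * (C (a : K) * (X * derivative K φ.y - C (b : K) * φ.y)) := by
    rw [h.logForm_eq, map_neg, map_mul, map_mul, toAlgHom_C, toAlgHom_C, toAlgHom_X_zero,
      toAlgHom_X_one, h.x_eq]
    ring
  have hcoeff : ∀ n, coeff n (C (a : K) * (X * derivative K φ.y - C (b : K) * φ.y)) =
      a * ((n - b) * coeff n φ.y) := fun n => by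
    rw [coeff_C_mul, map_sub, coeff_C_mul, coeff_X_mul_derivative]
    ring
  refine mem_semimodule_of_coeff (A := -(MvPowerSeries.C (b : K) * .X 1))
    (B := MvPowerSeries.C (a : K) * .X 0) (fun m hm => ?_) ?_
  · rw [e, coeff_X_pow_mul']
    split_ifs with h1
    · rw [hcoeff, h.coeff_y (by omega)]
      split_ifs with h2
      · rw [h2, sub_self, zero_mul, mul_zero]
      · rw [mul_zero, mul_zero]
    · rfl
  · rw [e, coeff_X_pow_mul, hcoeff]
    exact mul_ne_zero haK (mul_ne_zero (cast_sub_cast_ne_zero (p := p) hbk hkp) hy)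

theorem exists_aequiv_succ {p : ℕ} [Fact p.Prime] [CharP K p] (h : φ.IsClose a b k)
    (hdvd : ¬ a ∣ b) (hkp : k < p) (hΛ : k + a ∈ φ.semimodule → k + a ∈ φ.semigroup) :
    ∃ χ, χ.IsClose a b (k + 1) ∧ φ.AEquiv χ := by
  have hpos := h.pos
  have hab := h.lt_right
  have hbk := h.lt_bound
  have haK : (a : K) ≠ 0 := cast_ne_zero_of_lt (p := p) hpos (by omega)
  have hbK : (b : K) ≠ 0 := cast_ne_zero_of_lt (p := p) (by omega) (by omega)
  by_cases hy : coeff k φ.y = 0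
  · exact ⟨φ, h.succ_of_coeff_eq_zero hy, AEquiv.refl φ⟩
  obtain ⟨i, j, hij⟩ := h.exists_eq_of_mem_semigroup hdvd (hΛ (h.add_mem_semimodule hkp hy))
  -- A monomial form of value `k + a = ai + bj` serves: `x^(i-1) y^j dx` if `i > 0`, and `y^(j-1)
  -- dy` otherwise, where `j ≥ 2` because `k + a > b`.
  obtain ⟨A, hA, B, hB, h0, hn⟩ : ∃ A ∈ MvPowerSeries.weightIdeal K ![a, b] (b + 1),
      ∃ B ∈ MvPowerSeries.weightIdeal K ![a, b] (a + 1),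
      (∀ m < k + a, coeff m (φ.logForm A B) = 0) ∧ coeff (k + a) (φ.logForm A B) ≠ 0 := by
    have hX0 : (.X 0 : MvPowerSeries (Fin 2) K) ∈ MvPowerSeries.weightIdeal K ![a, b] a :=
      MvPowerSeries.X_mem_weightIdeal (R := K) ![a, b] 0
    have hX1 : (.X 1 : MvPowerSeries (Fin 2) K) ∈ MvPowerSeries.weightIdeal K ![a, b] b :=
      MvPowerSeries.X_mem_weightIdeal (R := K) ![a, b] 1
    rcases i with _ | i
    · have hj : 2 ≤ j := by
        rcases mul_trichotomy b j with h | h | h <;> omega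
      obtain ⟨j, rfl⟩ : ∃ j', j = j' + 1 := ⟨j - 1, by omega⟩
      have hcoeff : ∀ m ≤ k + a, coeff m (φ.logForm 0 (.X 1 ^ j)) =
          if m = a * 0 + b * (j + 1) then (b : K) else 0 := fun m hm => by
        rw [← h.coeff_mono_mul_derivative (by rw [mul_add] at hij; omega), h.logForm_eq, map_pow,
          toAlgHom_X_one]
        simp
      refine ⟨0, Ideal.zero_mem _, .X 1 ^ j, ?_, fun m hm => ?_, ?_⟩
      · refine MvPowerSeries.weightIdeal_antitone _ ?_ (MvPowerSeries.pow_mem_weightIdeal hX1 j)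
        have : b * 1 ≤ b * j := Nat.mul_le_mul_left b (by omega)
        omega
      · rw [hcoeff m hm.le, if_neg (by omega)]
      · rw [hcoeff _ le_rfl, if_pos hij]
        exact hbK
    · have hcoeff : ∀ m ≤ k + a, coeff m (φ.logForm (.X 0 ^ i * .X 1 ^ j) 0) =
          if m = a * (i + 1) + b * j then (a : K) else 0 := fun m hm => by
        rw [h.logForm_eq, map_mul, map_pow, map_pow, toAlgHom_X_zero, toAlgHom_X_one, mono_mul_x,
          map_zero, zero_mul, add_zero, coeff_C_mul, h.coeff_mono (by omega)]
        simp
      refine ⟨.X 0 ^ i * .X 1 ^ j, ?_, 0, Ideal.zero_mem _, fun m hm => ?_, ?_⟩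
      · refine MvPowerSeries.weightIdeal_antitone _ ?_ (MvPowerSeries.mul_mem_weightIdeal
          (MvPowerSeries.pow_mem_weightIdeal hX0 i) (MvPowerSeries.pow_mem_weightIdeal hX1 j))
        rw [mul_add] at hij
        omega
      · rw [hcoeff m hm.le, if_neg (by omega)]
      · rw [hcoeff _ le_rfl, if_pos hij]
        exact haK
  obtain ⟨χ, hχx, hχy, hχ⟩ := h.exists_aequiv_add (p := p) hbk hkp hA hB h0 hn (-coeff k φ.y)
  refine ⟨χ, ⟨hpos, hab, by omega, hχx, ?_⟩, hχ⟩
  have h1 : X ^ (k + 1) ∣ φ.y + C (-coeff k φ.y) * X ^ k - X ^ b := by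
    rw [X_pow_dvd_iff]
    intro m hm
    rw [map_sub, map_add, coeff_C_mul, coeff_X_pow, coeff_X_pow]
    rcases Nat.lt_succ_iff_lt_or_eq.mp hm with hm | rfl
    · rw [h.coeff_y hm, if_neg (show m ≠ k by omega)]
      simp
    · rw [if_pos rfl, if_neg (by omega)]
      ring
  have := dvd_add hχy h1
  rwa [sub_add_sub_cancel] at this

theorem exists_aequiv_of_le {p : ℕ} [Fact p.Prime] [CharP K p] (h : φ.IsClose a b (b + 1))
    (hdvd : ¬ a ∣ b) {N : ℕ} (hbN : b < N) (hNp : N ≤ p)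
    (hΛ : ∀ k < N, k + a ∈ φ.semimodule → k + a ∈ φ.semigroup) :
    ∃ χ, χ.IsClose a b N ∧ φ.AEquiv χ := by
  induction N, hbN using Nat.le_induction with
  | base => exact ⟨φ, h, AEquiv.refl φ⟩
  | succ n hbn ih =>
    obtain ⟨χ, hχ, hφχ⟩ := ih (by omega) fun k hk => hΛ k (by omega)
    obtain ⟨χ', hχ', hχχ'⟩ := hχ.exists_aequiv_succ (p := p) hdvd (by omega)
      (by rw [hφχ.semigroup_eq, hφχ.semimodule_eq]; exact hΛ n (by omega))
    exact ⟨χ', hχ', hφχ.trans hχχ'⟩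

/-- Rescaling makes the coefficient of the first term after `t^b` equal to one. -/
theorem exists_aequiv_coeff_eq_one [IsAlgClosed K] (h : φ.IsClose a b k)
    (hy : coeff k φ.y ≠ 0) : ∃ χ, χ.IsClose a b k ∧ coeff k χ.y = 1 ∧ φ.AEquiv χ := by
  have hpos := h.pos
  have hab := h.lt_right
  have hbk := h.lt_bound
  -- The substitution `t ↦ ρt`, normalized by `ρ^(-a)` on `x` and `ρ^(-b)` on `y`, multiplies the
  -- coefficient of `t^k` by `ρ^(k - b)`.
  obtain ⟨ρ, hρ⟩ := IsAlgClosed.exists_pow_nat_eq (coeff k φ.y)⁻¹ (show 0 < k - b by omega)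
  have hρ0 : ρ ≠ 0 := by
    rintro rfl
    rw [zero_pow (by omega)] at hρ
    exact inv_ne_zero hy hρ.symm
  have hresc : ∀ (u : K) (f : K⟦X⟧) (n : ℕ), coeff n (rescaleAlgHom u f) = u ^ n * coeff n f :=
    fun u f n => by rw [← coeff_rescale, ← coe_rescaleAlgHom]; rfl
  let r : K⟦X⟧ ≃ₐ[K] K⟦X⟧ := AlgEquiv.ofAlgHom (rescaleAlgHom ρ) (rescaleAlgHom ρ⁻¹)
    (by ext f n; simp [hresc, hρ0]) (by ext f n; simp [hresc, hρ0])
  have hr : ∀ f n, coeff n (r f) = ρ ^ n * coeff n f := hresc ρ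
  have hv : ∀ s, ![ρ⁻¹ ^ a, ρ⁻¹ ^ b] s * ![ρ ^ a, ρ ^ b] s = 1 := fun s => by
    fin_cases s <;> simp [hρ0]
  let l : MvPowerSeries (Fin 2) K ≃ₐ[K] MvPowerSeries (Fin 2) K :=
    AlgEquiv.ofAlgHom (MvPowerSeries.rescaleAlgHom ![ρ⁻¹ ^ a, ρ⁻¹ ^ b])
      (MvPowerSeries.rescaleAlgHom ![ρ ^ a, ρ ^ b])
      (by
        rw [← MvPowerSeries.rescaleAlgHom_mul, ← MvPowerSeries.rescaleAlgHom_one]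
        congr 1; ext s; simpa [mul_comm] using hv s)
      (by
        rw [← MvPowerSeries.rescaleAlgHom_mul, ← MvPowerSeries.rescaleAlgHom_one]
        congr 1; ext s; simpa using hv s)
  have hl : ∀ s, l (.X s) = MvPowerSeries.C (![ρ⁻¹ ^ a, ρ⁻¹ ^ b] s) * .X s := fun s => by
    change MvPowerSeries.rescaleAlgHom _ _ = _
    ext d
    rw [MvPowerSeries.rescaleAlgHom_apply, MvPowerSeries.coeff_rescale, MvPowerSeries.coeff_C_mul,
      MvPowerSeries.coeff_X]
    split_ifs with hd
    · subst hd
      simp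
    · simp
  have hψ : ∀ s, φ.toAlgHom (l (.X s)) = C (![ρ⁻¹ ^ a, ρ⁻¹ ^ b] s) * φ.toAlgHom (.X s) :=
    fun s => by rw [hl, map_mul, toAlgHom_C]
  have hψ0 : φ.toAlgHom (l (.X 0)) = C (ρ⁻¹ ^ a) * X ^ a := by
    rw [hψ, toAlgHom_X_zero, h.x_eq]; rfl
  have hψ1 : φ.toAlgHom (l (.X 1)) = C (ρ⁻¹ ^ b) * φ.y := by
    rw [hψ, toAlgHom_X_one]; rfl
  set χ := φ.transform l r (hψ0 ▸ Dvd.dvd.mul_left (dvd_pow_self X hpos.ne') _)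
    (hψ1 ▸ Dvd.dvd.mul_left φ.X_dvd_y _)
    (hψ0 ▸ mul_ne_zero ((map_ne_zero C).mpr (by simp [hρ0])) (pow_ne_zero a X_ne_zero))
  have hχx : χ.x = X ^ a := by
    change r _ = _
    rw [hψ0]
    ext n
    rw [hr, coeff_C_mul, coeff_X_pow]
    split_ifs with hn
    · subst hn
      simp [hρ0]
    · simp
  have hχy : ∀ n, coeff n χ.y = ρ ^ n * (ρ⁻¹ ^ b * coeff n φ.y) := fun n => by
    change coeff n (r _) = _
    rw [hψ1, hr, coeff_C_mul]
  refine ⟨χ, ⟨hpos, hab, hbk, hχx, X_pow_dvd_iff.mpr fun m hm => ?_⟩, ?_,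
    φ.aequiv_transform _ _ _ _ _⟩
  · rw [map_sub, hχy, h.coeff_y hm, coeff_X_pow]
    split_ifs with hmb
    · subst hmb
      simp [hρ0]
    · simp
  · rw [hχy]
    have : ρ ^ k = ρ ^ (k - b) * ρ ^ b := by rw [← pow_add]; congr 1; omega
    rw [this, hρ, inv_pow]
    field_simp

/-- Elimination of all terms beyond `t^k` and below order `N` that are tangent to the orbit. -/
theorem exists_aequiv_eliminate {p : ℕ} [Fact p.Prime] [CharP K p] (h : φ.IsClose a b k)
    (hdvd : ¬ a ∣ b) (hk : k + a ∉ φ.semigroup) (hy : coeff k φ.y = 1) {N : ℕ} (hkN : k < N)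
    (hNp : N ≤ p) : ∃ χ, χ.IsClose a b k ∧ coeff k χ.y = 1 ∧
      (∀ i, k < i → i < N → i + a ∈ φ.semimodule → coeff i χ.y = 0) ∧ φ.AEquiv χ := by
  have hpos := h.pos
  have hab := h.lt_right
  have hbk := h.lt_bound
  have haK : (a : K) ≠ 0 := cast_ne_zero_of_lt (p := p) hpos (by omega)
  have hbK : (b : K) ≠ 0 := cast_ne_zero_of_lt (p := p) (by omega) (by omega)
  have hkb : (k : K) - b ≠ 0 := cast_sub_cast_ne_zero (p := p) hbk (by omega)
  induction N, hkN using Nat.le_induction with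
  | base => exact ⟨φ, h, hy, fun i h1 h2 => by omega, AEquiv.refl φ⟩
  | succ n hkn ih =>
    obtain ⟨χ, hχ, hχy, hχΛ, hφχ⟩ := ih (by omega)
    by_cases hn : n + a ∈ φ.semimodule
    · have hform : ∀ i j, k + a ≠ a * i + b * j := fun i j e =>
        hk (e ▸ h.mem_semigroup i j)
      have hn' := hn
      rw [← hφχ.semimodule_eq] at hn'
      obtain ⟨A, B, h0, hne⟩ := exists_of_mem_semimodule hn' (by omega)
      -- The value `n + a` exceeds `k + a`, so both coefficients of the linear system vanish and the
      -- form is admissible for the flow.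
      obtain ⟨hA, hB⟩ := hχ.weight_of_coeff_eq_zero hdvd haK hkb hbK hform
        (by rw [hχy]; exact one_ne_zero) fun m hm => h0 m (by omega)
      obtain ⟨χ', hx', hy', hχχ'⟩ := hχ.exists_aequiv_add (p := p) (by omega) (by omega) hA hB h0
        hne (-coeff n χ.y)
      have hcoeff : ∀ m, m ≤ n → coeff m χ'.y = if m = n then 0 else coeff m χ.y := by
        intro m hm
        have := X_pow_dvd_iff.mp hy' m (by omega)
        rw [map_sub, map_add, coeff_C_mul, coeff_X_pow, sub_eq_zero] at this
        rw [this]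
        split_ifs with hmn
        · subst hmn; ring
        · ring
      refine ⟨χ', ⟨hpos, hab, hbk, hx', X_pow_dvd_iff.mpr fun m hm => ?_⟩, ?_, ?_,
        hφχ.trans hχχ'⟩
      · rw [map_sub, hcoeff m (by omega), if_neg (by omega), ← map_sub]
        exact X_pow_dvd_iff.mp hχ.y_sub m hm
      · rw [hcoeff k (by omega), if_neg (by omega), hχy]
      · intro i hi hi' hiΛ
        rw [hcoeff i (by omega)]
        split_ifs with hin
        · rfl
        · exact hχΛ i hi (by omega) hiΛ
    · refine ⟨χ, hχ, hχy, fun i hi hi' hiΛ => ?_, hφχ⟩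
      rcases Nat.lt_succ_iff_lt_or_eq.mp hi' with h1 | rfl
      · exact hχΛ i hi h1 hiΛ
      · exact absurd hiΛ hn

end IsClose

end PlaneParametrization

open scoped Classical in
/-- In the normal form of `y`, the middle series is the monomial `t^λ`, which is `0` if
`λ = ∞`; the last series is the sum of `β i * t^i` over `i > λ` with `i + a ∉ Λ`. -/
theorem corollary7p6 {K : Type*} [Field K] [IsAlgClosed K] (p : ℕ) [CharP K p]
    (ψ : PlaneParametrization K) (hprim : ψ.IsPrimitive)
    (a b : ℕ) (ha : 0 < a) (hab : a < b) (hdvd : a = 1 ∨ ¬ a ∣ b)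
    (α : ℕ → K)
    (hx : ψ.x = PowerSeries.X ^ a)
    (hy : ψ.y = PowerSeries.X ^ b + PowerSeries.mk (fun i => if b < i then α i else 0))
    (hp : ψ.conductor < p) :
    ∃ (φ : PlaneParametrization K) (β : ℕ → K),
      φ.x = PowerSeries.X ^ a ∧
      φ.y = PowerSeries.X ^ b
        + PowerSeries.mk (fun i => if (i : ℕ∞) = ψ.zariskiNumber then 1 else 0)
        + PowerSeries.mk (fun i =>
            if ψ.zariskiNumber < (i : ℕ∞) ∧ i + a ∉ ψ.semimodule then β i else 0) ∧
      ψ.AEquiv φ := by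
  -- `p = 0` is excluded because the conductor is smaller than `p`.
  have hprime : Fact p.Prime := by
    rcases CharP.char_is_prime_or_zero K p with h | h
    · exact ⟨h⟩
    · omega
  have hclose : ψ.IsClose a b (b + 1) := by
    refine ⟨ha, hab, Nat.lt_succ_self b, hx, PowerSeries.X_pow_dvd_iff.mpr fun m hm => ?_⟩
    rw [hy, add_sub_cancel_left, PowerSeries.coeff_mk, if_neg (by omega)]
  have hC : ψ.ContainsOrder ψ.conductor := hprim.containsOrder_conductor hx
  set c := ψ.conductor with hc
  let χ₀ : PlaneParametrization K :=
    .ofPow a ha (PowerSeries.X ^ b) (dvd_pow_self _ (by omega))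
  -- The monomial curve has `Λ ⊆ Γ`; by invariance `λ = ∞`, and both correction series vanish.
  have hmono : ψ.AEquiv χ₀ → ∃ (φ : PlaneParametrization K) (β : ℕ → K),
      φ.x = PowerSeries.X ^ a ∧
      φ.y = PowerSeries.X ^ b
        + PowerSeries.mk (fun i => if (i : ℕ∞) = ψ.zariskiNumber then 1 else 0)
        + PowerSeries.mk (fun i =>
            if ψ.zariskiNumber < (i : ℕ∞) ∧ i + a ∉ ψ.semimodule then β i else 0) ∧
      ψ.AEquiv φ := by
    intro h
    have htop : ψ.zariskiNumber = ⊤ := by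
      refine PlaneParametrization.zariskiNumber_eq_top ?_
      rw [← h.semigroup_eq, ← h.semimodule_eq]
      exact PlaneParametrization.semimodule_subset_semigroup_of_monomial ha hab rfl rfl
    refine ⟨χ₀, 0, rfl, ?_, h⟩
    change PowerSeries.X ^ b = _
    ext n
    simp [htop]
  rcases Nat.lt_or_ge (b + 1) c with hbc | hcb
  swap
  · refine hmono (hclose.aequiv_of_dvd_sub hdvd hC hcb (Nat.lt_succ_self b) rfl ?_)
    exact hclose.y_sub
  -- If `a = 1` the local ring is all of `K⟦t⟧` and the conductor is `0`, contrary to `b + 1 < c`.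
  have hdvd' : ¬ a ∣ b := by
    refine hdvd.resolve_left ?_
    rintro rfl
    have h0 := hC.of_x_eq_X (by rw [hx, pow_one])
    have : c ≤ 0 := Nat.sInf_le ⟨h0.mem_semigroup le_rfl, fun n => h0.mem_semigroup (Nat.zero_le _)⟩
    omega
  have hbK : (b : K) ≠ 0 :=
    PlaneParametrization.cast_ne_zero_of_lt (p := p) (by omega) (by omega)
  have hbound : ∀ s ∈ ψ.semimodule, s ∉ ψ.semigroup → a + b < s := by
    intro s hs hns
    have hform : ∀ i j, s ≠ a * i + b * j := fun i j e => hns (e ▸ hclose.mem_semigroup i j)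
    obtain ⟨A, B, h0, hne⟩ :=
      PlaneParametrization.exists_of_mem_semimodule hs (by simpa using hform 0 0)
    exact hclose.lt_of_coeff_ne_zero hdvd' hbK hform h0 hne
  rcases ψ.zariskiNumber_cases hclose.multiplicity_eq hbound with
    hsub | ⟨L, hL, hbL, hLΛ, hLΓ, hmin⟩
  · obtain ⟨χ, hχ, hψχ⟩ := hclose.exists_aequiv_of_le (p := p) hdvd' (N := c) (by omega) hp.le
      fun k _ hk => hsub hk
    refine hmono (hψχ.trans ?_)
    exact (hχ.mono (Nat.lt_succ_self b) (by omega)).aequiv_of_dvd_sub hdvd (hψχ.containsOrder hC)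
      le_rfl (by omega) rfl hχ.y_sub
  · have hLc : L < c := by
      by_contra h
      exact hLΓ (hC.mem_semigroup (by omega))
    obtain ⟨χ₁, hχ₁, hψχ₁⟩ := hclose.exists_aequiv_of_le (p := p) hdvd' (N := L) hbL (by omega)
      fun k hk hkΛ => hmin _ hkΛ (by omega)
    have hform : ∀ i j, L + a ≠ a * i + b * j := fun i j e =>
      hLΓ (e ▸ hclose.mem_semigroup i j)
    -- Every form with `B(0) = 0` has a coefficient at `L + a` proportional to that of `t^L` in `y`;
    -- were the latter zero, `L + a` could not be a value.
    have hne : PowerSeries.coeff L χ₁.y ≠ 0 := by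
      intro h0
      obtain ⟨A, B, hAB, hAB'⟩ := PlaneParametrization.exists_of_mem_semimodule
        (hψχ₁.semimodule_eq.symm ▸ hLΛ) (by omega)
      have hB := hχ₁.coeff_zero_eq_zero hdvd' hbK (hAB b (by omega))
      rw [hχ₁.coeff_logForm_add_of_notMem hform hB, h0, zero_mul] at hAB'
      exact hAB' rfl
    obtain ⟨χ₂, hχ₂, hχ₂y, hχ₁χ₂⟩ := hχ₁.exists_aequiv_coeff_eq_one hne
    have hψχ₂ := hψχ₁.trans hχ₁χ₂
    obtain ⟨χ₃, hχ₃, hχ₃y, hχ₃Λ, hχ₂χ₃⟩ := hχ₂.exists_aequiv_eliminate (p := p) hdvd'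
      (hψχ₂.semigroup_eq.symm ▸ hLΓ) hχ₂y hLc hp.le
    rw [hψχ₂.semimodule_eq] at hχ₃Λ
    have hψχ₃ := hψχ₂.trans hχ₂χ₃
    -- Elimination by flows stops at the conductor; the tail from there on is cut off and absorbed
    -- by a coordinate change.
    let y : K⟦X⟧ := PowerSeries.mk fun i => if i < c then PowerSeries.coeff i χ₃.y else 0
    have hyc : ∀ i, PowerSeries.coeff i y = if i < c then PowerSeries.coeff i χ₃.y else 0 :=
      fun i => PowerSeries.coeff_mk _ _
    have hyX : PowerSeries.X ∣ y := by
      rw [PowerSeries.X_dvd_iff, ← PowerSeries.coeff_zero_eq_constantCoeff_apply, hyc,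
        if_pos (by omega), hχ₃.coeff_y (by omega), if_neg (by omega)]
    refine ⟨.ofPow a ha y hyX, fun i => PowerSeries.coeff i y, rfl, ?_, hψχ₃.trans ?_⟩
    · change y = _
      ext i
      rw [hL]
      simp only [map_add, PowerSeries.coeff_X_pow, PowerSeries.coeff_mk, Nat.cast_inj,
        Nat.cast_lt, hyc]
      rcases lt_trichotomy i L with h1 | rfl | h1
      · rw [hχ₃.coeff_y h1]
        simp [show i < c by omega, h1.ne, h1.not_gt]
      · simp [hχ₃y, hLc, hbL.ne']
      · by_cases h2 : i < c
        · by_cases h3 : i + a ∈ ψ.semimodule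
          · simp [hχ₃Λ i h1 h2 h3, h3, h1.ne', (hbL.trans h1).ne']
          · simp [h1, h2, h3, h1.ne', (hbL.trans h1).ne']
        · simp [h2, h1.ne', (hbL.trans h1).ne']
    · refine (hχ₃.mono (Nat.lt_succ_self b) hbL).aequiv_of_dvd_sub hdvd (hψχ₃.containsOrder hC)
        le_rfl (by omega) rfl (PowerSeries.X_pow_dvd_iff.mpr fun m hm => ?_)
      change PowerSeries.coeff m (χ₃.y - y) = 0
      rw [map_sub, hyc, if_pos hm, sub_self]
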